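/- Let $E$ be a Polish space with Borel $\sigma$-algebra $\mathscr B$, and let $C_b(E)$ be the space of bounded continuous functions $E\to\mathbb R$, endowed with the mixed topology $\tau^{\mathscr M}$, i.e. the locally convex topology generated by the seminorms $$p_{(C_n),(a_n)}(\varphi)=\sup_{n}\sup_{x\in C_n} a_n|\varphi(x)|,\qquad C_n\subset E \text{ compact},\quad 0<a_n\to 0 .$$ Let $P=(P_t)_{t\ge 0}$ be a (possibly nonlinear) $C_0$-semigroup on $(C_b(E),\tau^{\mathscr M})$, that is, a family of maps $P_t\colon C_b(E)\to C_b(E)$ such that $P_0\varphi=\varphi$ and $P_sP_t\varphi=P_{s+t}\varphi$ for all $s,t\ge0$ and $\varphi\in C_b(E)$; for every $T\ge 0$, $\varepsilon>0$ and every seminorm $p$ as above there are such a seminorm $q$ and $\delta>0$ such that, for all $t\in[0,T]$ and $\varphi_1,\varphi_2\in C_b(E)$, $q(\varphi_1-\varphi_2)<\delta$ implies $p(P_t\varphi_1-P_t\varphi_2)<\varepsilon$; and $P_t\varphi\to\varphi$ in $\tau^{\mathscr M}$ as $t\downarrow0$ for every $\varphi\in C_b(E)$. Assume that every $P_t$ is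 increasing ($\varphi_1\le\varphi_2$ implies $P_t\varphi_1\le P_t\varphi_2$), convex ($P_t(\lambda\varphi_1+(1-\lambda)\varphi_2)\le\lambda P_t\varphi_1+(1-\lambda)P_t\varphi_2$ for $\lambda\in[0,1]$), and satisfies $P_tm=m$ for all constants $m\in\mathbb R$. For a measurable space $(\Omega,\mathcal F)$ let $B_b(\Omega,\mathcal F)$ be the space of bounded $\mathcal F$-measurable functions $\Omega\to\mathbb R$. A convex expectation is a map $\mathcal E\colon B_b(\Omega,\mathcal F)\to\mathbb R$ that is increasing with respect to the pointwise order, satisfies $\mathcal E(m)=m$ for all constants $m\in\mathbb R$, and is convex; $(\Omega,\mathcal F,\mathcal E)$ is a convex expectation space if $\mathcal E$ is a convex expectation and there exist a set $\mathcal P$ of probability measures on $(\Omega,\mathcal F)$ and a function $\alpha\colon\mathcal P\to[0,\infty)$ with $\mathcal E(Y)=\sup_{\mathbb P\in\mathcal P}\big(\mathbb E_{\mathbb P}(Y)-\alpha(\mathbb P)\big)$ for all $Y\in B_b(\Omega,\mathcal F)$. Then there exist a measurable space $(\Omega,\mathcal F)$, functionals $\mathcal E^x\colon B_b(\Omega,\mathcal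 F)\to\mathbb R$ for $x\in E$, and maps $X(t)\colon\Omega\to E$ for $t\ge0$, such that (i) $X(t)$ is $\mathcal F$-$\mathscr B$-measurable for all $t\ge0$; (ii) $(\Omega,\mathcal F,\mathcal E^x)$ is a convex expectation space and $\mathcal E^x(\varphi(X(0)))=\varphi(x)$ for all $x\in E$ and $\varphi\in C_b(E)$; (iii) for all $x\in E$, $0\le s<t$, $n\in\mathbb N$, $0\le t_1<\dots<t_n\le s$ and $\psi\in C_b(E^{n+1})$, $$\mathcal E^x\big(\psi(X(t_1),\dots,X(t_n),X(t))\big)=\mathcal E^x\Big(\big(P_{t-s}\psi(X(t_1),\dots,X(t_n),\,\cdot\,)\big)(X(s))\Big),$$ where the arguments of $\mathcal E^x$ on both sides belong to $B_b(\Omega,\mathcal F)$. In particular, $(P_t\varphi)(x)=\mathcal E^x(\varphi(X(t)))$ for all $t\ge0$, $x\in E$ and $\varphi\in C_b(E)$. -/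

import Mathlib

open Filter Topology MeasureTheory Set
open scoped NNReal BoundedContinuousFunction

universe u

noncomputable section


/-! ### The mixed topology on bounded continuous functions -/

/-- Indices of the seminorms of the mixed topology: a sequence of compact sets `C n` together with a
sequence of positive reals `a n` tending to `0`. -/
structure MixedIndex (E : Type u) [TopologicalSpace E] where
  C : ℕ → Set E
  a : ℕ → ℝ
  isCompact : ∀ n, IsCompact (C n)
  pos : ∀ n, 0 < a n
  tendsto : Tendsto a atTop (𝓝 0)

theorem MixedIndex.exists_bound {E : Type u} [TopologicalSpace E] (i : MixedIndex E) :
    ∃ K : ℝ, 0 ≤ K ∧ ∀ n, i.a n ≤ K := by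
  obtain ⟨K, hK⟩ := i.tendsto.bddAbove_range
  exact ⟨K, (i.pos 0).le.trans (hK ⟨0, rfl⟩), fun n => hK ⟨n, rfl⟩⟩

theorem MixedIndex.term_le {E : Type u} [TopologicalSpace E] (i : MixedIndex E) (φ : E →ᵇ ℝ)
    (n : ℕ) (x : E) : i.a n * |φ x| ≤ i.a n * ‖φ‖ :=
  mul_le_mul_of_nonneg_left (φ.norm_coe_le_norm x) (i.pos n).le

theorem MixedIndex.bddAbove_inner {E : Type u} [TopologicalSpace E] (i : MixedIndex E)
    (φ : E →ᵇ ℝ) (n : ℕ) : BddAbove (range fun x : i.C n => i.a n * |φ x|) :=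
  ⟨i.a n * ‖φ‖, by rintro _ ⟨x, rfl⟩; exact i.term_le φ n x⟩

theorem MixedIndex.bddAbove_outer {E : Type u} [TopologicalSpace E] (i : MixedIndex E)
    (φ : E →ᵇ ℝ) : BddAbove (range fun n => ⨆ x : i.C n, i.a n * |φ x|) := by
  obtain ⟨K, hK0, hK⟩ := i.exists_bound
  refine ⟨K * ‖φ‖, ?_⟩
  rintro _ ⟨n, rfl⟩
  exact Real.iSup_le (fun x => (i.term_le φ n x).trans
    (mul_le_mul_of_nonneg_right (hK n) (norm_nonneg φ))) (mul_nonneg hK0 (norm_nonneg φ))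

theorem MixedIndex.le_iSup {E : Type u} [TopologicalSpace E] (i : MixedIndex E) (φ : E →ᵇ ℝ)
    (n : ℕ) (x : i.C n) : i.a n * |φ x| ≤ ⨆ n, ⨆ x : i.C n, i.a n * |φ x| :=
  (le_ciSup (i.bddAbove_inner φ n) x).trans (le_ciSup (i.bddAbove_outer φ) n)

theorem MixedIndex.iSup_nonneg {E : Type u} [TopologicalSpace E] (i : MixedIndex E)
    (φ : E →ᵇ ℝ) : 0 ≤ ⨆ n, ⨆ x : i.C n, i.a n * |φ x| :=
  Real.iSup_nonneg fun n => Real.iSup_nonneg fun _ => mul_nonneg (i.pos n).le (abs_nonneg _)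

/-- The seminorm `φ ↦ sup_n sup_{x ∈ C n} a n * |φ x|` on bounded continuous functions. -/
def mixedSeminorm (E : Type u) [TopologicalSpace E] : SeminormFamily ℝ (E →ᵇ ℝ) (MixedIndex E) :=
  fun i => Seminorm.of (fun φ => ⨆ n, ⨆ x : i.C n, i.a n * |φ x|)
    (fun φ ψ => by
      have h0 := add_nonneg (i.iSup_nonneg φ) (i.iSup_nonneg ψ)
      refine Real.iSup_le (fun n => Real.iSup_le (fun x => ?_) h0) h0
      calc i.a n * |(φ + ψ) x| ≤ i.a n * (|φ x| + |ψ x|) :=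
            mul_le_mul_of_nonneg_left (abs_add_le _ _) (i.pos n).le
        _ = i.a n * |φ x| + i.a n * |ψ x| := mul_add _ _ _
        _ ≤ _ := add_le_add (i.le_iSup φ n x) (i.le_iSup ψ n x))
    (fun c φ => by
      rw [Real.mul_iSup_of_nonneg (norm_nonneg c)]
      congr 1; funext n
      rw [Real.mul_iSup_of_nonneg (norm_nonneg c)]
      congr 1; funext x
      simp only [BoundedContinuousFunction.coe_smul, smul_eq_mul, abs_mul, Real.norm_eq_abs]
      ring)

instance MixedIndex.instNonempty (E : Type u) [TopologicalSpace E] : Nonempty (MixedIndex E) :=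
  ⟨{ C := fun _ => ∅
     a := fun n => 1 / ((n : ℝ) + 1)
     isCompact := fun _ => isCompact_empty
     pos := fun _ => by positivity
     tendsto := tendsto_one_div_add_atTop_nhds_zero_nat }⟩

/-- The mixed topology on `C_b(E)`: the locally convex topology generated by the seminorms
`mixedSeminorm E i`. -/
@[reducible] def mixedTopology (E : Type u) [TopologicalSpace E] : TopologicalSpace (E →ᵇ ℝ) :=
  (mixedSeminorm E).moduleFilterBasis.topology

/-! ### Semigroups -/

/-- A (not necessarily linear) `C₀`-semigroup on `C_b(E)` with the mixed topology. -/
structure IsMixedC0Semigroup {E : Type u} [TopologicalSpace E]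
    (P : ℝ≥0 → (E →ᵇ ℝ) → (E →ᵇ ℝ)) : Prop where
  zero : ∀ φ, P 0 φ = φ
  add : ∀ s t φ, P s (P t φ) = P (s + t) φ
  /-- local uniform equicontinuity for the mixed topology -/
  equicontinuous : ∀ (T : ℝ≥0) (ε : ℝ), 0 < ε → ∀ i : MixedIndex E,
    ∃ (j : MixedIndex E) (δ : ℝ), 0 < δ ∧ ∀ t ≤ T, ∀ φ₁ φ₂ : E →ᵇ ℝ,
      mixedSeminorm E j (φ₁ - φ₂) < δ → mixedSeminorm E i (P t φ₁ - P t φ₂) < ε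
  /-- strong right continuity at `0` for the mixed topology -/
  rightContinuous : ∀ φ, Tendsto (fun t => P t φ) (𝓝[>] 0) (@nhds _ (mixedTopology E) φ)

/-! ### Convex expectations -/

/-- The space `B_b(Ω, 𝓕)` of bounded measurable functions `Ω → ℝ`. -/
def BddMeas (Ω : Type u) [MeasurableSpace Ω] : Submodule ℝ (Ω → ℝ) where
  carrier := {Y | Measurable Y ∧ ∃ K : ℝ, ∀ ω, |Y ω| ≤ K}
  add_mem' := by
    rintro Y Z ⟨hY, K, hK⟩ ⟨hZ, L, hL⟩
    exact ⟨hY.add hZ, K + L, fun ω => (abs_add_le _ _).trans (add_le_add (hK ω) (hL ω))⟩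
  zero_mem' := ⟨measurable_const, 0, fun ω => by simp⟩
  smul_mem' := by
    rintro c Y ⟨hY, K, hK⟩
    refine ⟨hY.const_smul c, |c| * K, fun ω => ?_⟩
    simpa [abs_mul] using mul_le_mul_of_nonneg_left (hK ω) (abs_nonneg c)

/-- A real number, as a constant element of `B_b(Ω, 𝓕)`. -/
def BddMeas.const (Ω : Type u) [MeasurableSpace Ω] (m : ℝ) : BddMeas Ω :=
  ⟨fun _ => m, measurable_const, |m|, fun _ => le_rfl⟩

/-- Convex expectations on `B_b(Ω, 𝓕)`. -/
structure IsConvexExpectation {Ω : Type u} [MeasurableSpace Ω] (𝓔 : BddMeas Ω → ℝ) : Prop where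
  mono : ∀ Y Z : BddMeas Ω, (∀ ω, Y.1 ω ≤ Z.1 ω) → 𝓔 Y ≤ 𝓔 Z
  const : ∀ m : ℝ, 𝓔 (BddMeas.const Ω m) = m
  convex : ∀ (Y Z : BddMeas Ω) (l : ℝ), 0 ≤ l → l ≤ 1 →
    𝓔 (l • Y + (1 - l) • Z) ≤ l * 𝓔 Y + (1 - l) * 𝓔 Z

/-- `(Ω, 𝓕, 𝓔)` is a convex expectation space: `𝓔` is a convex expectation and there are a set `𝓠`
of probability measures and a penalty `α : 𝓠 → [0, ∞)` with
`𝓔 Y = sup_{ℙ ∈ 𝓠} (𝔼_ℙ Y - α ℙ)` for all `Y`. -/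
def IsConvexExpectationSpace (Ω : Type u) [MeasurableSpace Ω] (𝓔 : BddMeas Ω → ℝ) : Prop :=
  IsConvexExpectation 𝓔 ∧
    ∃ (𝓠 : Set (ProbabilityMeasure Ω)) (α : 𝓠 → ℝ≥0), ∀ Y : BddMeas Ω,
      IsLUB (range fun ℙ : 𝓠 => (∫ ω, Y.1 ω ∂(ℙ.1 : Measure Ω)) - (α ℙ : ℝ)) (𝓔 Y)

/-- For `ψ ∈ C_b(E^{n+1})` and `x ∈ E^n`, the function `y ↦ ψ (x₁, …, xₙ, y)` in `C_b(E)`. -/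
def sliceLast {E : Type u} [TopologicalSpace E] {n : ℕ} (ψ : (Fin (n + 1) → E) →ᵇ ℝ)
    (x : Fin n → E) : E →ᵇ ℝ :=
  ψ.compContinuous ⟨fun y => Fin.snoc (α := fun _ => E) x y,
    continuous_const.finSnoc continuous_id⟩

end

noncomputable section

/-! ### Convex Markov semigroups -/

/-! The process is the coordinate process on the path space `ℝ≥0 → E`. On bounded continuous
functions of finitely many coordinates its expectation is forced by the Markov property: apply the
semigroup backwards, from the last time to the first (`finsetExp`). The semigroup law and the
preservation of constants make the value independent of the time set used (`cylinderExp_eq`), so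
this is a single increasing convex functional `cylinderExp` with the Markov property built in.

Fenchel duality extends it to bounded measurable functions: `pathExp` is the supremum over path
measures of the integral minus a penalty, the penalty being the convex conjugate of `cylinderExp`.
On cylinder functions it is at most `cylinderExp` by definition of the conjugate; equality requires
at each of them a subgradient that is a measure.

Hahn–Banach provides a positive normalized subgradient (`exists_supporting_functional`), a priori
only finitely additive. Equicontinuity in the mixed topology makes its one-time marginals tight, and
on a Polish space this suffices for a representing probability measure on cylinder functions
(`exists_probabilityMeasure_integral_eq`): embed `E` in the Hilbert cube, apply Riesz on the compact
product, and use tightness to see that no mass leaves the image of `E`. -/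

/-- A `C₀`-semigroup for the mixed topology which is increasing, convex and preserves constants. -/
structure IsConvexMarkovSemigroup {E : Type u} [TopologicalSpace E]
    (P : ℝ≥0 → (E →ᵇ ℝ) → (E →ᵇ ℝ)) : Prop extends IsMixedC0Semigroup P where
  mono : ∀ t, Monotone (P t)
  convex : ∀ t (φ₁ φ₂ : E →ᵇ ℝ) (l : ℝ), 0 ≤ l → l ≤ 1 →
    P t (l • φ₁ + (1 - l) • φ₂) ≤ l • P t φ₁ + (1 - l) • P t φ₂
  const : ∀ t (m : ℝ),
    P t (BoundedContinuousFunction.const E m) = BoundedContinuousFunction.const E m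

theorem MixedIndex.mixedSeminorm_apply {E : Type u} [TopologicalSpace E] (i : MixedIndex E)
    (φ : E →ᵇ ℝ) : mixedSeminorm E i φ = ⨆ n, ⨆ x : i.C n, i.a n * |φ x| := rfl

/-- A seminorm of the mixed topology is small on bounded functions which are small on a suitable
compact set. -/
theorem MixedIndex.exists_compact_bound {E : Type u} [TopologicalSpace E] (i : MixedIndex E)
    {M δ : ℝ} (hM : 0 ≤ M) (hδ : 0 < δ) :
    ∃ K : Set E, IsCompact K ∧ ∃ η : ℝ, 0 < η ∧ ∀ φ : E →ᵇ ℝ, (∀ x, |φ x| ≤ M) →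
      (∀ x ∈ K, |φ x| ≤ η) → mixedSeminorm E i φ < δ := by
  have h1 : ∀ᶠ n in atTop, i.a n < δ / 2 / (M + 1) :=
    i.tendsto.eventually (gt_mem_nhds (by positivity))
  -- From `N` on, the weights are so small that the global bound `M` suffices; only the finitely
  -- many earlier compact sets need to enter `K`.
  obtain ⟨N, hN⟩ := eventually_atTop.1 h1
  obtain ⟨B, hB0, hB⟩ := i.exists_bound
  refine ⟨⋃ n ∈ Finset.range N, i.C n,
    (Finset.range N).isCompact_biUnion fun n _ => i.isCompact n, δ / 2 / (B + 1),
    by positivity, fun φ hφ hK => ?_⟩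
  rw [i.mixedSeminorm_apply]
  refine lt_of_le_of_lt (Real.iSup_le (fun n => Real.iSup_le (fun x => ?_) ?_) ?_)
    (half_lt_self hδ)
  · rcases lt_or_ge n N with hn | hn
    · have h2 := hK x (mem_biUnion (Finset.mem_range.2 hn) x.2)
      calc i.a n * |φ x| ≤ (B + 1) * (δ / 2 / (B + 1)) :=
            mul_le_mul ((hB n).trans (by linarith)) h2 (abs_nonneg _) (by positivity)
        _ = δ / 2 := by field_simp
    · calc i.a n * |φ x| ≤ (δ / 2 / (M + 1)) * (M + 1) :=
            mul_le_mul (hN n hn).le ((hφ x).trans (by linarith)) (abs_nonneg _) (by positivity)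
        _ = δ / 2 := by field_simp
  · positivity
  · positivity

/-- For a compact set `K`, the sup norm over `K` is dominated by a seminorm of the mixed
topology. -/
theorem exists_mixedIndex_ge {E : Type u} [TopologicalSpace E] {K : Set E} (hK : IsCompact K) :
    ∃ i : MixedIndex E, ∀ φ : E →ᵇ ℝ, ∀ x ∈ K, |φ x| ≤ mixedSeminorm E i φ := by
  refine ⟨{ C := fun _ => K
            a := fun n => 1 / ((n : ℝ) + 1)
            isCompact := fun _ => hK
            pos := fun _ => by positivity
            tendsto := tendsto_one_div_add_atTop_nhds_zero_nat }, fun φ x hx => ?_⟩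
  -- The term of index `0` has weight `1`, so it alone dominates `|φ x|`.
  have h := MixedIndex.le_iSup { C := fun _ => K
                                 a := fun n => 1 / ((n : ℝ) + 1)
                                 isCompact := fun _ => hK
                                 pos := fun _ => by positivity
                                 tendsto := tendsto_one_div_add_atTop_nhds_zero_nat } φ 0 ⟨x, hx⟩
  simpa [MixedIndex.mixedSeminorm_apply] using h

namespace IsConvexMarkovSemigroup

variable {E : Type u} [TopologicalSpace E] {P : ℝ≥0 → (E →ᵇ ℝ) → (E →ᵇ ℝ)}

theorem abs_apply_le (hP : IsConvexMarkovSemigroup P) (t : ℝ≥0) {φ : E →ᵇ ℝ} {M : ℝ}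
    (h : ∀ x, |φ x| ≤ M) (x : E) : |P t φ x| ≤ M := by
  have h1 : P t φ ≤ P t (BoundedContinuousFunction.const E M) :=
    hP.mono t fun y => (abs_le.1 (h y)).2
  have h2 : P t (BoundedContinuousFunction.const E (-M)) ≤ P t φ :=
    hP.mono t fun y => (abs_le.1 (h y)).1
  rw [hP.const] at h1 h2
  exact abs_le.2 ⟨h2 x, h1 x⟩

/-- Joint continuity of the semigroup in a parameter. -/
theorem continuous_param (hP : IsConvexMarkovSemigroup P) (t : ℝ≥0) {W : Type*}
    [TopologicalSpace W] [FirstCountableTopology W] (F : W → (E →ᵇ ℝ)) {M : ℝ}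
    (hF : Continuous fun p : W × E => F p.1 p.2) (hM : ∀ w y, |F w y| ≤ M) {v : W → E}
    (hv : Continuous v) : Continuous fun w => P t (F w) (v w) := by
  refine continuous_iff_seqContinuous.2 fun w w₀ hw => ?_
  have hM0 : 0 ≤ M := (abs_nonneg _).trans (hM w₀ (v w₀))
  have hvw : Tendsto (fun k => v (w k)) atTop (𝓝 (v w₀)) := (hv.tendsto w₀).comp hw
  -- The points `v (w k)` and their limit form a compact set, on which `P t (F (w k)) - P t (F w₀)`
  -- is made uniformly small.
  obtain ⟨i, hi⟩ := exists_mixedIndex_ge hvw.isCompact_insert_range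
  have h1 : Tendsto (fun k => P t (F (w k)) (v (w k)) - P t (F w₀) (v (w k))) atTop (𝓝 0) := by
    rw [Metric.tendsto_nhds]
    intro ε hε
    obtain ⟨j, δ, hδ, hj⟩ := hP.equicontinuous t ε hε i
    obtain ⟨K, hK, η, hη, hKη⟩ := j.exists_compact_bound (M := 2 * M) (by positivity) hδ
    -- By currying, joint continuity gives `F (w k) → F w₀` uniformly on `K`; off `K` the bound `2 *
    -- M` is enough.
    have hcont : Continuous fun w => (⟨fun y => F w y, (F w).continuous⟩ : C(E, ℝ)) :=
      (ContinuousMap.curry ⟨fun p : W × E => F p.1 p.2, hF⟩).continuous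
    have h2 := (ContinuousMap.tendsto_iff_forall_isCompact_tendstoUniformlyOn.1
      (hcont.tendsto w₀)) K hK
    rw [Metric.tendstoUniformlyOn_iff] at h2
    filter_upwards [hw.eventually (h2 η hη)] with k hk
    have h3 := hj t le_rfl (F (w k)) (F w₀) (hKη _ (fun y => ?_) fun y hy => ?_)
    · have h4 := hi (P t (F (w k)) - P t (F w₀)) (v (w k)) (Or.inr ⟨k, rfl⟩)
      rw [dist_zero_right, Real.norm_eq_abs]
      exact h4.trans_lt h3
    · have h4 := hM (w k) y
      have h5 := hM w₀ y
      calc |(F (w k) - F w₀) y| = |F (w k) y - F w₀ y| := rfl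
        _ ≤ |F (w k) y| + |F w₀ y| := abs_sub _ _
        _ ≤ 2 * M := by linarith
    · have h4 := hk y hy
      rw [dist_comm, Real.dist_eq] at h4
      exact h4.le
  have h2 : Tendsto (fun k => P t (F w₀) (v (w k))) atTop (𝓝 (P t (F w₀) (v w₀))) :=
    ((P t (F w₀)).continuous.tendsto _).comp hvw
  simpa [Function.comp_def] using h1.add h2

/-- `P t` is continuous from above along functions vanishing on large compact sets. -/
theorem exists_compact_lt (hP : IsConvexMarkovSemigroup P) (t : ℝ≥0) (x : E) {M : ℝ}
    (hM : 0 ≤ M) : ∃ K : Set E, IsCompact K ∧ ∀ φ : E →ᵇ ℝ, (∀ y, |φ y| ≤ M) →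
      (∀ y ∈ K, φ y = 0) → P t φ x < 1 := by
  obtain ⟨i, hi⟩ := exists_mixedIndex_ge (isCompact_singleton (x := x))
  obtain ⟨j, δ, hδ, hj⟩ := hP.equicontinuous t 1 one_pos i
  obtain ⟨K, hK, η, hη, hKη⟩ := j.exists_compact_bound hM hδ
  refine ⟨K, hK, fun φ hφ h0 => ?_⟩
  have h1 := hj t le_rfl φ 0 (by
    rw [sub_zero]
    exact hKη φ hφ fun y hy => by rw [h0 y hy, abs_zero]; exact hη.le)
  have h2 := (hi (P t φ - P t 0) x rfl).trans_lt h1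
  have h3 : P t (0 : E →ᵇ ℝ) = 0 := hP.const t 0
  rw [h3, sub_zero] at h2
  exact (le_abs_self _).trans_lt h2

end IsConvexMarkovSemigroup

/-! ### Paths determined by finitely many coordinates -/

section Path

variable {T E : Type*}

open Classical in
/-- The path which agrees with `z` on `J` and with `ω₀` elsewhere. -/
def extendPath (J : Finset T) (ω₀ : T → E) (z : J → E) : T → E :=
  fun r => if h : r ∈ J then z ⟨r, h⟩ else ω₀ r

theorem extendPath_of_mem {J : Finset T} (ω₀ : T → E) (z : J → E) {r : T} (h : r ∈ J) :
    extendPath J ω₀ z r = z ⟨r, h⟩ := dif_pos h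

theorem continuous_extendPath [TopologicalSpace E] (J : Finset T) (ω₀ : T → E) :
    Continuous (extendPath J ω₀) := by
  refine continuous_pi fun r => ?_
  by_cases hr : r ∈ J
  · simp only [extendPath, hr, dite_true]
    exact continuous_apply _
  · simp only [extendPath, hr, dite_false]
    exact continuous_const

theorem DependsOn.apply_extendPath {β : Type*} {J : Finset T} {f : (T → E) → β}
    (hf : DependsOn f (J : Set T)) (ω₀ ω : T → E) :
    f (extendPath J ω₀ fun r => ω r) = f ω :=
  hf fun _ hr => extendPath_of_mem ω₀ _ hr

/-- For uncountable `T` the product `σ`-algebra can be smaller than the Borel one, so continuity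
alone would not suffice. Here `f` factors through a finite product, where the two agree by second
countability. -/
theorem DependsOn.measurable [TopologicalSpace E] [SecondCountableTopology E] [MeasurableSpace E]
    [BorelSpace E] {J : Finset T} {f : (T → E) → ℝ} (hf : DependsOn f (J : Set T))
    (hc : Continuous f) : Measurable f := by
  rcases isEmpty_or_nonempty (T → E) with h | ⟨⟨ω₀⟩⟩
  · exact measurable_of_empty f
  have h1 : f = (fun z : J → E => f (extendPath J ω₀ z)) ∘ fun ω s => ω s :=
    funext fun ω => (hf.apply_extendPath ω₀ ω).symm
  rw [h1]
  exact (hc.comp (continuous_extendPath J ω₀)).measurable.comp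
    (measurable_pi_lambda _ fun s => measurable_pi_apply _)

/-- Evaluation of a bounded continuous function at a coordinate. -/
def evalAt [TopologicalSpace E] (t : T) (φ : E →ᵇ ℝ) : (T → E) →ᵇ ℝ :=
  φ.compContinuous ⟨fun ω => ω t, continuous_apply t⟩

theorem dependsOn_evalAt [TopologicalSpace E] (t : T) (φ : E →ᵇ ℝ) :
    DependsOn (evalAt t φ) (({t} : Finset T) : Set T) :=
  fun _ _ h => congrArg φ (h t (by simp))

end Path

/-! ### Transition operators on cylinder functions -/

section Transition

variable {E : Type u} [TopologicalSpace E]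

/-- The function `y ↦ f (ω[t ↦ y])`. -/
def sliceAt (f : (ℝ≥0 → E) →ᵇ ℝ) (t : ℝ≥0) (ω : ℝ≥0 → E) : E →ᵇ ℝ :=
  f.compContinuous ⟨fun y => Function.update ω t y, continuous_const.update t continuous_id⟩

@[simp]
theorem sliceAt_apply (f : (ℝ≥0 → E) →ᵇ ℝ) (t : ℝ≥0) (ω : ℝ≥0 → E) (y : E) :
    sliceAt f t ω y = f (Function.update ω t y) := rfl

theorem abs_sliceAt_le (f : (ℝ≥0 → E) →ᵇ ℝ) (t : ℝ≥0) (ω : ℝ≥0 → E) (y : E) :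
    |sliceAt f t ω y| ≤ ‖f‖ := f.norm_coe_le_norm _

open Classical in
/-- Integrating out the time `t` given the position at time `s`: this is the bounded continuous
function `ω ↦ P (t - s) (y ↦ f (ω[t ↦ y])) (ω s)`, and `0` if that function fails to be bounded and
continuous. -/
def transition (P : ℝ≥0 → (E →ᵇ ℝ) → (E →ᵇ ℝ)) (s t : ℝ≥0) (f : (ℝ≥0 → E) →ᵇ ℝ) :
    (ℝ≥0 → E) →ᵇ ℝ :=
  if h : Continuous (fun ω : ℝ≥0 → E => P (t - s) (sliceAt f t ω) (ω s)) ∧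
      ∀ ω : ℝ≥0 → E, ‖P (t - s) (sliceAt f t ω) (ω s)‖ ≤ ‖f‖ then
    BoundedContinuousFunction.ofNormedAddCommGroup _ h.1 ‖f‖ h.2
  else 0

/-- Bounded continuous functions on the path space which depend on finitely many coordinates. -/
def IsCylinder (f : (ℝ≥0 → E) →ᵇ ℝ) : Prop :=
  ∃ J : Finset ℝ≥0, DependsOn f (J : Set ℝ≥0)

variable {P : ℝ≥0 → (E →ᵇ ℝ) → (E →ᵇ ℝ)}

theorem sliceAt_congr {f : (ℝ≥0 → E) →ᵇ ℝ} {J : Set ℝ≥0} (hf : DependsOn f J) {t : ℝ≥0}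
    {ω ω' : ℝ≥0 → E} (h : ∀ r ∈ J, r ≠ t → ω r = ω' r) : sliceAt f t ω = sliceAt f t ω' := by
  ext y
  refine hf fun r hr => ?_
  by_cases hrt : r = t
  · subst hrt; simp
  · simp [hrt, h r hr hrt]

theorem isCylinder_const (m : ℝ) :
    IsCylinder (BoundedContinuousFunction.const (ℝ≥0 → E) m) :=
  ⟨∅, fun _ _ _ => rfl⟩

theorem IsCylinder.add {f g : (ℝ≥0 → E) →ᵇ ℝ} (hf : IsCylinder f) (hg : IsCylinder g) :
    IsCylinder (f + g) := by
  obtain ⟨J, hJ⟩ := hf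
  obtain ⟨J', hJ'⟩ := hg
  refine ⟨J ∪ J', fun ω ω' h => ?_⟩
  rw [BoundedContinuousFunction.add_apply, BoundedContinuousFunction.add_apply,
    hJ fun r hr => h r (by simp [Finset.mem_coe.1 hr]),
    hJ' fun r hr => h r (by simp [Finset.mem_coe.1 hr])]

theorem IsCylinder.smul {f : (ℝ≥0 → E) →ᵇ ℝ} (hf : IsCylinder f) (c : ℝ) :
    IsCylinder (c • f) := by
  obtain ⟨J, hJ⟩ := hf
  refine ⟨J, fun ω ω' h => ?_⟩
  change c • f ω = c • f ω'
  rw [hJ h]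

/-! ### The expectation of a cylinder function -/

/-- The expectation of `f` for the paths starting in `x`, where the times of `J` are integrated out
successively, the last one first. -/
def finsetExp (P : ℝ≥0 → (E →ᵇ ℝ) → (E →ᵇ ℝ)) (x : E) (J : Finset ℝ≥0)
    (f : (ℝ≥0 → E) →ᵇ ℝ) : ℝ :=
  if h : J.Nonempty then
    -- When the smallest time is removed the remaining `sup` is `0`, so the first transition starts
    -- at time `0`, where the constant path of the base case sits in `x`.
    finsetExp P x (J.erase (J.max' h))
      (transition P ((J.erase (J.max' h)).sup id) (J.max' h) f)
  else f fun _ => x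
termination_by J.card
decreasing_by exact Finset.card_erase_lt_of_mem (J.max'_mem h)

theorem finsetExp_empty (x : E) (f : (ℝ≥0 → E) →ᵇ ℝ) : finsetExp P x ∅ f = f fun _ => x := by
  rw [finsetExp, dif_neg (by simp)]

theorem finsetExp_insert (x : E) {J : Finset ℝ≥0} {t : ℝ≥0} (h : ∀ r ∈ J, r < t)
    (f : (ℝ≥0 → E) →ᵇ ℝ) :
    finsetExp P x (insert t J) f = finsetExp P x J (transition P (J.sup id) t f) := by
  have h1 : (insert t J).max' (Finset.insert_nonempty t J) = t :=
    le_antisymm (Finset.max'_le _ _ _ fun r hr => by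
      rcases Finset.mem_insert.1 hr with rfl | hr
      exacts [le_rfl, (h r hr).le]) (Finset.le_max' _ _ (Finset.mem_insert_self _ _))
  have h2 : t ∉ J := fun ht => lt_irrefl _ (h t ht)
  rw [finsetExp, dif_pos (Finset.insert_nonempty t J), h1, Finset.erase_insert h2]

open Classical in
/-- The expectation of a cylinder function for the paths starting in `x`. -/
def cylinderExp (P : ℝ≥0 → (E →ᵇ ℝ) → (E →ᵇ ℝ)) (x : E) (f : (ℝ≥0 → E) →ᵇ ℝ) : ℝ :=
  if h : IsCylinder f then finsetExp P x h.choose f else 0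

variable [FirstCountableTopology E]

/-! ### Properties of a single transition -/

namespace IsConvexMarkovSemigroup

/-- The default branch never occurs for cylinder functions. The path space need not be first
countable, but the map factors through `(J → E) × E`, which is, so `continuous_param` applies there.
-/
theorem transition_apply (hP : IsConvexMarkovSemigroup P)
    {f : (ℝ≥0 → E) →ᵇ ℝ} (hf : IsCylinder f) (s t : ℝ≥0) (ω : ℝ≥0 → E) :
    transition P s t f ω = P (t - s) (sliceAt f t ω) (ω s) := by
  have h : Continuous (fun ω : ℝ≥0 → E => P (t - s) (sliceAt f t ω) (ω s)) ∧
      ∀ ω : ℝ≥0 → E, ‖P (t - s) (sliceAt f t ω) (ω s)‖ ≤ ‖f‖ := by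
    refine ⟨?_, fun ω => hP.abs_apply_le _ (abs_sliceAt_le f t ω) _⟩
    obtain ⟨J, hJ⟩ := hf
    have h1 : Continuous fun p : (J → E) × E =>
        P (t - s) (sliceAt f t (extendPath J ω p.1)) p.2 := by
      refine hP.continuous_param (t - s) (W := (J → E) × E)
        (fun p => sliceAt f t (extendPath J ω p.1)) ?_ (fun p y => abs_sliceAt_le f t _ y) continuous_snd
      exact f.continuous.comp
        (((continuous_extendPath J ω).comp (continuous_fst.comp continuous_fst)).update t
          continuous_snd)
    have h2 : (fun ω : ℝ≥0 → E => P (t - s) (sliceAt f t ω) (ω s)) =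
        (fun p : (J → E) × E => P (t - s) (sliceAt f t (extendPath J ω p.1)) p.2) ∘
          fun ω => (fun r : J => ω r, ω s) := by
      funext ω'
      simp only [Function.comp]
      rw [sliceAt_congr hJ (t := t) (ω := ω') 
        (ω' := extendPath J ω fun r : J => ω' r)]
      intro r hr _
      rw [extendPath_of_mem _ _ hr]
    rw [h2]
    exact h1.comp ((continuous_pi fun r => continuous_apply _).prodMk (continuous_apply s))
  rw [transition, dif_pos h]
  rfl

theorem dependsOn_transition (hP : IsConvexMarkovSemigroup P) {f : (ℝ≥0 → E) →ᵇ ℝ}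
    (hf : IsCylinder f) {J : Set ℝ≥0} (hJ : DependsOn f J) (s t : ℝ≥0) :
    DependsOn (transition P s t f) (insert s (J \ {t})) := by
  intro ω ω' h
  rw [hP.transition_apply hf, hP.transition_apply hf, h s (mem_insert _ _),
    sliceAt_congr hJ fun r hr hrt => h r (Or.inr ⟨hr, hrt⟩)]

theorem isCylinder_transition (hP : IsConvexMarkovSemigroup P) {f : (ℝ≥0 → E) →ᵇ ℝ}
    (hf : IsCylinder f) (s t : ℝ≥0) : IsCylinder (transition P s t f) := by
  obtain ⟨J, hJ⟩ := id hf
  refine ⟨insert s (J.erase t), ?_⟩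
  rw [Finset.coe_insert, Finset.coe_erase]
  exact hP.dependsOn_transition hf hJ s t

theorem transition_mono (hP : IsConvexMarkovSemigroup P) {f g : (ℝ≥0 → E) →ᵇ ℝ}
    (hf : IsCylinder f) (hg : IsCylinder g) (h : f ≤ g) (s t : ℝ≥0) :
    transition P s t f ≤ transition P s t g := by
  intro ω
  change transition P s t f ω ≤ transition P s t g ω
  rw [hP.transition_apply hf, hP.transition_apply hg]
  exact hP.mono _ (fun y => h _) _

theorem transition_eq_self (hP : IsConvexMarkovSemigroup P) {f : (ℝ≥0 → E) →ᵇ ℝ}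
    (hf : IsCylinder f) {t : ℝ≥0} (hft : DependsOn f {t}ᶜ) (s : ℝ≥0) :
    transition P s t f = f := by
  ext ω
  have h : sliceAt f t ω = BoundedContinuousFunction.const E (f ω) := by
    ext y
    refine hft fun r hr => ?_
    simp [show r ≠ t from hr]
  rw [hP.transition_apply hf, h, hP.const]
  rfl

/-- Chapman–Kolmogorov: as `f` ignores the time `u`, slicing the inner transition at `u` gives `P (t
- u)` of the slice of `f`, and the semigroup law merges both steps. -/
theorem transition_transition (hP : IsConvexMarkovSemigroup P) {f : (ℝ≥0 → E) →ᵇ ℝ}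
    (hf : IsCylinder f) {s u t : ℝ≥0} (hsu : s ≤ u) (hut : u < t) (hfu : DependsOn f {u}ᶜ) :
    transition P s u (transition P u t f) = transition P s t f := by
  ext ω
  have h : sliceAt (transition P u t f) u ω = P (t - u) (sliceAt f t ω) := by
    ext y
    rw [sliceAt_apply, hP.transition_apply hf, Function.update_self,
      sliceAt_congr hfu (ω' := ω) fun r hr _ => by simp [show r ≠ u from hr]]
  rw [hP.transition_apply (hP.isCylinder_transition hf u t), h, hP.add,
    hP.transition_apply hf, add_comm, tsub_add_tsub_cancel hut.le hsu]

/-! ### Iterated transitions and their independence of the time set -/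

theorem finsetExp_mono (hP : IsConvexMarkovSemigroup P) (x : E) (J : Finset ℝ≥0)
    {f g : (ℝ≥0 → E) →ᵇ ℝ} (hf : IsCylinder f) (hg : IsCylinder g) (h : f ≤ g) :
    finsetExp P x J f ≤ finsetExp P x J g := by
  induction J using Finset.induction_on_max generalizing f g with
  | empty => rw [finsetExp_empty, finsetExp_empty]; exact h _
  | insert t J ht ih =>
    rw [finsetExp_insert x ht, finsetExp_insert x ht]
    exact ih (hP.isCylinder_transition hf _ _) (hP.isCylinder_transition hg _ _)
      (hP.transition_mono hf hg h _ _)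

theorem finsetExp_const (hP : IsConvexMarkovSemigroup P) (x : E) (J : Finset ℝ≥0) (m : ℝ) :
    finsetExp P x J (BoundedContinuousFunction.const _ m) = m := by
  induction J using Finset.induction_on_max with
  | empty => rw [finsetExp_empty]; rfl
  | insert t J ht ih =>
    rw [finsetExp_insert x ht, hP.transition_eq_self (isCylinder_const m) (fun _ _ _ => rfl), ih]

theorem finsetExp_convex (hP : IsConvexMarkovSemigroup P) (x : E) (J : Finset ℝ≥0)
    {f g : (ℝ≥0 → E) →ᵇ ℝ} (hf : IsCylinder f) (hg : IsCylinder g) {l : ℝ} (h0 : 0 ≤ l)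
    (h1 : l ≤ 1) : finsetExp P x J (l • f + (1 - l) • g) ≤
      l * finsetExp P x J f + (1 - l) * finsetExp P x J g := by
  induction J using Finset.induction_on_max generalizing f g with
  | empty => simp [finsetExp_empty]
  | insert t J ht ih =>
    rw [finsetExp_insert x ht, finsetExp_insert x ht, finsetExp_insert x ht]
    have hf' := hP.isCylinder_transition hf (J.sup id) t
    have hg' := hP.isCylinder_transition hg (J.sup id) t
    have hfg := (hf.smul l).add (hg.smul (1 - l))
    -- Convexity of the last transition passes through the earlier ones because these are also
    -- monotone.
    refine (hP.finsetExp_mono x J (hP.isCylinder_transition hfg _ _)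
      ((hf'.smul l).add (hg'.smul (1 - l))) fun ω => ?_).trans (ih hf' hg')
    change transition P _ _ _ ω ≤ l * transition P _ _ f ω + (1 - l) * transition P _ _ g ω
    rw [hP.transition_apply hfg, hP.transition_apply hf, hP.transition_apply hg]
    exact hP.convex (t - J.sup id) (sliceAt f t ω) (sliceAt g t ω) l h0 h1 (ω (J.sup id))

/-- Integrating out an irrelevant time does not change the expectation. -/
theorem finsetExp_insert_eq (hP : IsConvexMarkovSemigroup P) (x : E) (J : Finset ℝ≥0)
    {u : ℝ≥0} (hu : u ∉ J) {f : (ℝ≥0 → E) →ᵇ ℝ} (hf : IsCylinder f)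
    (hfu : DependsOn f {u}ᶜ) : finsetExp P x (insert u J) f = finsetExp P x J f := by
  induction J using Finset.induction_on_max generalizing f with
  | empty =>
    rw [finsetExp_insert x (by simp), hP.transition_eq_self hf hfu]
  | insert t J ht ih =>
    have hut : u ≠ t := fun h => hu (by simp [h])
    have huJ : u ∉ J := fun h => hu (by simp [h])
    rcases lt_or_gt_of_ne hut with hut | hut
    · rw [Finset.insert_comm, finsetExp_insert x (J := insert u J) (t := t), finsetExp_insert x ht,
        Finset.sup_insert]
      -- If `u` lies below the predecessor of `t`, the last transition is unaffected and induction
      -- applies. Otherwise `u` is itself the new predecessor, and the two transitions across it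
      -- merge.
      · rcases lt_or_ge u (J.sup id) with h | h
        · rw [id, sup_eq_right.2 h.le]
          refine ih huJ (hP.isCylinder_transition hf _ _)
            ((hP.dependsOn_transition hf hfu _ _).mono ?_)
          rintro r (rfl | hr)
          exacts [h.ne', hr.1]
        · rw [id, sup_eq_left.2 h, finsetExp_insert x, hP.transition_transition hf h hut hfu]
          intro r hr
          exact lt_of_le_of_ne ((Finset.le_sup (f := id) hr).trans h) fun h => huJ (h ▸ hr)
      · intro r hr
        rcases Finset.mem_insert.1 hr with rfl | hr
        exacts [hut, ht r hr]
    · rw [finsetExp_insert x (J := insert t J), hP.transition_eq_self hf hfu]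
      intro r hr
      rcases Finset.mem_insert.1 hr with rfl | hr
      exacts [hut, (ht r hr).trans hut]

theorem finsetExp_union_eq (hP : IsConvexMarkovSemigroup P) (x : E) {J : Finset ℝ≥0}
    {f : (ℝ≥0 → E) →ᵇ ℝ} (hf : DependsOn f (J : Set ℝ≥0)) (J' : Finset ℝ≥0) :
    finsetExp P x (J' ∪ J) f = finsetExp P x J f := by
  induction J' using Finset.induction_on with
  | empty => simp
  | insert u J' hu ih =>
    rw [Finset.insert_union]
    by_cases h : u ∈ J' ∪ J
    · rw [Finset.insert_eq_of_mem h, ih]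
    · rw [hP.finsetExp_insert_eq x _ h ⟨J, hf⟩ (hf.mono fun r hr h' => h ?_), ih]
      rw [← show r = u from h']
      exact Finset.mem_union_right _ hr

/-- Kolmogorov consistency: the chosen time set and `J` both give the value computed on their union.
-/
theorem cylinderExp_eq (hP : IsConvexMarkovSemigroup P) (x : E) {J : Finset ℝ≥0}
    {f : (ℝ≥0 → E) →ᵇ ℝ} (hf : DependsOn f (J : Set ℝ≥0)) :
    cylinderExp P x f = finsetExp P x J f := by
  have h : IsCylinder f := ⟨J, hf⟩
  rw [cylinderExp, dif_pos h, ← hP.finsetExp_union_eq x hf h.choose,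
    ← hP.finsetExp_union_eq x h.choose_spec J, Finset.union_comm]

theorem exists_cylinderExp_eq (hP : IsConvexMarkovSemigroup P) (x : E)
    {f g k : (ℝ≥0 → E) →ᵇ ℝ} (hf : IsCylinder f) (hg : IsCylinder g) (hk : IsCylinder k) :
    ∃ J : Finset ℝ≥0, cylinderExp P x f = finsetExp P x J f ∧
      cylinderExp P x g = finsetExp P x J g ∧ cylinderExp P x k = finsetExp P x J k := by
  obtain ⟨J₁, h₁⟩ := hf
  obtain ⟨J₂, h₂⟩ := hg
  obtain ⟨J₃, h₃⟩ := hk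
  refine ⟨J₁ ∪ J₂ ∪ J₃, hP.cylinderExp_eq x (h₁.mono ?_), hP.cylinderExp_eq x (h₂.mono ?_),
    hP.cylinderExp_eq x (h₃.mono ?_)⟩ <;> intro r hr <;> simp [Finset.mem_coe.1 hr]

theorem cylinderExp_mono (hP : IsConvexMarkovSemigroup P) (x : E) {f g : (ℝ≥0 → E) →ᵇ ℝ}
    (hf : IsCylinder f) (hg : IsCylinder g) (h : f ≤ g) :
    cylinderExp P x f ≤ cylinderExp P x g := by
  obtain ⟨J, h1, h2, -⟩ := hP.exists_cylinderExp_eq x hf hg hg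
  rw [h1, h2]
  exact hP.finsetExp_mono x J hf hg h

theorem cylinderExp_const (hP : IsConvexMarkovSemigroup P) (x : E) (m : ℝ) :
    cylinderExp P x (BoundedContinuousFunction.const _ m) = m := by
  rw [hP.cylinderExp_eq x (J := ∅) fun _ _ _ => rfl, hP.finsetExp_const]

theorem cylinderExp_convex (hP : IsConvexMarkovSemigroup P) (x : E) {f g : (ℝ≥0 → E) →ᵇ ℝ}
    (hf : IsCylinder f) (hg : IsCylinder g) {l : ℝ} (h0 : 0 ≤ l) (h1 : l ≤ 1) :
    cylinderExp P x (l • f + (1 - l) • g) ≤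
      l * cylinderExp P x f + (1 - l) * cylinderExp P x g := by
  obtain ⟨J, e1, e2, e3⟩ :=
    hP.exists_cylinderExp_eq x hf hg ((hf.smul l).add (hg.smul (1 - l)))
  rw [e1, e2, e3]
  exact hP.finsetExp_convex x J hf hg h0 h1

/-- The Markov property. -/
theorem cylinderExp_transition (hP : IsConvexMarkovSemigroup P) (x : E) {f : (ℝ≥0 → E) →ᵇ ℝ}
    {J : Finset ℝ≥0} {s t : ℝ≥0} (hst : s < t) (hJ : ∀ r ∈ J, r ≤ s)
    (hf : DependsOn f (insert t J : Set ℝ≥0)) :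
    cylinderExp P x (transition P s t f) = cylinderExp P x f := by
  have h1 : (insert s J).sup id = s :=
    le_antisymm (Finset.sup_le fun r hr => by
      rcases Finset.mem_insert.1 hr with rfl | hr
      exacts [le_rfl, hJ r hr]) (Finset.le_sup (f := id) (Finset.mem_insert_self s J))
  have hc : IsCylinder f := ⟨insert t J, by rwa [Finset.coe_insert]⟩
  -- Adding the possibly irrelevant time `s` makes `s` the predecessor of `t`, so that the last
  -- transition is exactly the one from `s` to `t`.
  rw [hP.cylinderExp_eq x (f := f) (J := insert t (insert s J)), finsetExp_insert x, h1,
    hP.cylinderExp_eq x (J := insert s J)]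
  · refine (hP.dependsOn_transition hc hf s t).mono ?_
    rw [Finset.coe_insert]
    rintro r (rfl | ⟨rfl | hr, hrt⟩)
    exacts [Or.inl rfl, absurd rfl hrt, Or.inr hr]
  · intro r hr
    rcases Finset.mem_insert.1 hr with rfl | hr
    exacts [hst, (hJ r hr).trans_lt hst]
  · refine hf.mono ?_
    rw [Finset.coe_insert, Finset.coe_insert]
    exact insert_subset_insert (subset_insert _ _)

theorem cylinderExp_evalAt (hP : IsConvexMarkovSemigroup P) (x : E) (t : ℝ≥0) (φ : E →ᵇ ℝ) :
    cylinderExp P x (evalAt t φ) = P t φ x := by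
  have h1 := dependsOn_evalAt t φ
  rw [hP.cylinderExp_eq x h1, ← insert_empty_eq t, finsetExp_insert x (by simp), finsetExp_empty,
    hP.transition_apply ⟨_, h1⟩, Finset.sup_empty, NNReal.bot_eq_zero, tsub_zero]
  congr 2
  ext y
  simp [evalAt]

end IsConvexMarkovSemigroup

end Transition

/-! ### Representation of tight positive functionals on cylinder functions -/

/-- A positive linear functional on the continuous functions on a compact Hausdorff space is
represented on the measurable ones by a finite measure, for every `σ`-algebra of Borel sets. -/
theorem exists_measure_integral_eq {Z : Type*} [TopologicalSpace Z] [CompactSpace Z] [T2Space Z]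
    (Λ : C(Z, ℝ) →ₗ[ℝ] ℝ) (hΛ : ∀ g, 0 ≤ g → 0 ≤ Λ g) (m : MeasurableSpace Z)
    (hm : m ≤ borel Z) : ∃ μ : Measure Z, ∀ g : C(Z, ℝ), Measurable g → ∫ z, g z ∂μ = Λ g := by
  let Λ' : CompactlySupportedContinuousMap Z ℝ →ₚ[ℝ] ℝ := PositiveLinearMap.mk₀
    { toFun := fun f => Λ f.toContinuousMap
      map_add' := fun f g => by rw [← map_add]; rfl
      map_smul' := fun c f => by rw [RingHom.id_apply, ← map_smul]; rfl }
    fun f hf => hΛ _ hf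
  let _ : MeasurableSpace Z := borel Z
  have : BorelSpace Z := ⟨rfl⟩
  -- The Riesz measure lives on the Borel sets; restricting it to `m` preserves integrals of
  -- `m`-measurable functions.
  refine ⟨(RealRMK.rieszMeasure Λ').trim hm, fun g hg => ?_⟩
  rw [← integral_trim hm hg.stronglyMeasurable]
  exact RealRMK.integral_rieszMeasure Λ'
    (CompactlySupportedContinuousMap.continuousMapEquiv g)

/-- A positive normalized linear functional on `C(T → K)` is represented on the functions which are
measurable for the product `σ`-algebra by a probability measure. -/
theorem exists_measure_pi_integral_eq {T K : Type*} [TopologicalSpace K] [CompactSpace K]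
    [T2Space K] [m : MeasurableSpace K] [BorelSpace K] (Λ : C(T → K, ℝ) →ₗ[ℝ] ℝ)
    (hΛ : ∀ g, 0 ≤ g → 0 ≤ Λ g) (hΛ1 : Λ 1 = 1) :
    ∃ μ : Measure (T → K), IsProbabilityMeasure μ ∧
      ∀ g : C(T → K, ℝ), Measurable g → ∫ z, g z ∂μ = Λ g := by
  have hle : (MeasurableSpace.pi : MeasurableSpace (T → K)) ≤ borel (T → K) := by
    refine iSup_le fun t => ?_
    rw [BorelSpace.measurable_eq (α := K)]
    exact borel_comap.ge.trans (borel_anti (continuous_apply t).le_induced)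
  obtain ⟨μ, h⟩ := exists_measure_integral_eq Λ hΛ MeasurableSpace.pi hle
  refine ⟨μ, ⟨?_⟩, h⟩
  have h1 := h 1 measurable_const
  rw [hΛ1] at h1
  simp only [ContinuousMap.one_apply, integral_const, smul_eq_mul, mul_one] at h1
  rw [Measure.real, ENNReal.toReal_eq_one_iff] at h1
  exact h1

theorem abs_map_le_of_abs_le {X : Type*} [TopologicalSpace X] (ℓ : (X →ᵇ ℝ) →ₗ[ℝ] ℝ)
    (hpos : ∀ g, 0 ≤ g → 0 ≤ ℓ g) {f g : X →ᵇ ℝ} (h : ∀ x, |f x| ≤ g x) : |ℓ f| ≤ ℓ g := by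
  have h1 := hpos (g - f) fun x => sub_nonneg.2 (abs_le.1 (h x)).2
  have h2 := hpos (g + f) fun x => by
    have := (abs_le.1 (h x)).1
    change 0 ≤ g x + f x
    linarith
  rw [map_sub] at h1
  rw [map_add] at h2
  exact abs_le.2 ⟨by linarith, by linarith⟩

/-- `ℓ` charges the complement of `C` under the coordinate `t` with mass at most `ε`. -/
def HasTightCoord {T E : Type*} [TopologicalSpace E] (ℓ : ((T → E) →ᵇ ℝ) →ₗ[ℝ] ℝ) (t : T)
    (C : Set E) (ε : ℝ) : Prop :=
  ∀ φ : E →ᵇ ℝ, (∀ x, 0 ≤ φ x) → (∀ x, φ x ≤ 1) → (∀ x ∈ C, φ x = 0) → ℓ (evalAt t φ) ≤ ε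

/-- A tight positive functional is small on cylinder functions which vanish on a compact set. -/
theorem abs_map_le_of_tight {T E : Type*} [PseudoMetricSpace E] [Nonempty E]
    (ℓ : ((T → E) →ᵇ ℝ) →ₗ[ℝ] ℝ) (hpos : ∀ g, 0 ≤ g → 0 ≤ ℓ g) (hone : ℓ 1 = 1)
    {J : Finset T} {C : T → Set E} (hC : ∀ t, IsCompact (C t)) {ε : ℝ} (hε : 0 < ε)
    (htight : ∀ t, HasTightCoord ℓ t (C t) ε) {f : (T → E) →ᵇ ℝ}
    (hf : DependsOn f (J : Set T)) {M : ℝ} (hM : ∀ ω, |f ω| ≤ M)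
    (h0 : ∀ ω, (∀ t ∈ J, ω t ∈ C t) → f ω = 0) : |ℓ f| ≤ ε + M * (J.card * ε) := by
  classical
  obtain ⟨x₀⟩ := ‹Nonempty E›
  have hM0 : 0 ≤ M := (abs_nonneg _).trans (hM fun _ => x₀)
  let ext : (J → E) → T → E := extendPath J fun _ => x₀
  have hext : Continuous ext := continuous_extendPath J _
  have hfext : ∀ ω, f (ext fun r : J => ω r) = f ω := hf.apply_extendPath _
  have hopen : IsOpen {z | |f (ext z)| < ε} :=
    isOpen_lt (f.continuous.comp hext).abs continuous_const
  -- Compactness upgrades `f = 0` on the product of the `C t` to `|f| < ε` on a thickening; in the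
  -- sup metric this contains the product of the coordinate thickenings.
  obtain ⟨δ, hδ, hsub⟩ := (isCompact_univ_pi fun r : J => hC r).exists_thickening_subset_open
    hopen (fun z hz => by
      change |f (ext z)| < ε
      rw [h0 _ fun t ht => ?_, abs_zero]
      · exact hε
      · rw [show ext z t = z ⟨t, ht⟩ from extendPath_of_mem _ _ ht]
        exact hz ⟨t, ht⟩ (mem_univ _))
  let h : T → (E →ᵇ ℝ) := fun t => BoundedContinuousFunction.ofNormedAddCommGroup
    (fun y => 1 - (thickenedIndicator hδ (C t) y : ℝ))
    (continuous_const.sub (NNReal.continuous_coe.comp (thickenedIndicator hδ (C t)).continuous)) 1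
    (fun y => by
      have h1 := thickenedIndicator_le_one hδ (C t) y
      have h2 : (thickenedIndicator hδ (C t) y : ℝ) ≤ 1 := by exact_mod_cast h1
      rw [Real.norm_eq_abs, abs_of_nonneg (by linarith)]
      linarith [NNReal.coe_nonneg (thickenedIndicator hδ (C t) y)])
  have happ : ∀ t y, h t y = 1 - (thickenedIndicator hδ (C t) y : ℝ) := fun _ _ => rfl
  have hnn : ∀ t y, 0 ≤ h t y := fun t y => by
    have h1 := thickenedIndicator_le_one hδ (C t) y
    have h2 : (thickenedIndicator hδ (C t) y : ℝ) ≤ 1 := by exact_mod_cast h1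
    rw [happ]
    linarith
  have hle1 : ∀ t y, h t y ≤ 1 := fun t y => by
    rw [happ]
    linarith [NNReal.coe_nonneg (thickenedIndicator hδ (C t) y)]
  -- Either every coordinate is near its compact set and `|f| < ε`, or some `h t` equals `1` and the
  -- sum absorbs the bound `M`.
  have hG : ∀ ω, |f ω| ≤ (ε • (1 : (T → E) →ᵇ ℝ) + M • ∑ t ∈ J, evalAt t (h t)) ω := fun ω => by
    have happG : (ε • (1 : (T → E) →ᵇ ℝ) + M • ∑ t ∈ J, evalAt t (h t)) ω =
        ε + M * ∑ t ∈ J, h t (ω t) := by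
      rw [BoundedContinuousFunction.add_apply, BoundedContinuousFunction.smul_apply,
        BoundedContinuousFunction.smul_apply, BoundedContinuousFunction.sum_apply]
      simp [evalAt]
    rw [happG]
    have hsum : 0 ≤ ∑ t ∈ J, h t (ω t) := Finset.sum_nonneg fun t _ => hnn t _
    by_cases hω : ∀ t ∈ J, ω t ∈ Metric.thickening δ (C t)
    · have h1 : |f ω| < ε := by
        rw [← hfext ω]
        refine hsub (a := fun r : J => ω r) (Metric.mem_thickening_iff.2 ?_)
        have h2 : ∀ r : J, ∃ c ∈ C r, dist (ω r) c < δ := fun r =>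
          Metric.mem_thickening_iff.1 (hω r r.2)
        choose c hc hd using h2
        exact ⟨c, fun r _ => hc r, (dist_pi_lt_iff hδ).2 hd⟩
      exact h1.le.trans (le_add_of_nonneg_right (mul_nonneg hM0 hsum))
    · push Not at hω
      obtain ⟨t, ht, hωt⟩ := hω
      have h1 : h t (ω t) = 1 := by
        rw [happ, thickenedIndicator_zero hδ _ hωt]
        simp
      have h2 : 1 ≤ ∑ t ∈ J, h t (ω t) := by
        rw [← h1]
        exact Finset.single_le_sum (f := fun t => h t (ω t)) (fun t _ => hnn t _) ht
      calc |f ω| ≤ M * 1 := by rw [mul_one]; exact hM ω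
        _ ≤ M * ∑ t ∈ J, h t (ω t) := mul_le_mul_of_nonneg_left h2 hM0
        _ ≤ _ := le_add_of_nonneg_left hε.le
  refine (abs_map_le_of_abs_le ℓ hpos hG).trans ?_
  rw [map_add, map_smul, map_smul, map_sum, hone, smul_eq_mul, smul_eq_mul, mul_one]
  gcongr
  calc ∑ t ∈ J, ℓ (evalAt t (h t)) ≤ ∑ t ∈ J, ε := Finset.sum_le_sum fun t _ =>
        htight t (h t) (hnn t) (hle1 t) fun y hy => by
          rw [happ, thickenedIndicator_one hδ _ hy]
          simp
    _ = J.card * ε := by simp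

/-- A probability measure charges a closed set with mass at least `1 - ε`, if it integrates to at
most `ε` all continuous functions with values in `[0, 1]` which vanish on this set. -/
theorem measureReal_compl_le {K : Type*} [TopologicalSpace K] [MeasurableSpace K]
    [HasOuterApproxClosed K] [OpensMeasurableSpace K] (ν : Measure K) [IsProbabilityMeasure ν]
    {F : Set K} (hF : IsClosed F) {ε : ℝ}
    (h : ∀ φ : K →ᵇ ℝ, (∀ x, 0 ≤ φ x) → (∀ x, φ x ≤ 1) → (∀ x ∈ F, φ x = 0) →
      ∫ x, φ x ∂ν ≤ ε) : ν.real Fᶜ ≤ ε := by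
  -- The hypothesis is tested on `1 - hF.apprSeq n`, whose second term tends to the indicator of
  -- `F`.
  have h1 : ∀ n, ENNReal.ofReal (1 - ε) ≤ ∫⁻ x, hF.apprSeq n x ∂ν := fun n => by
    have hle : ∀ x, (hF.apprSeq n x : ℝ) ≤ 1 := fun x => by
      exact_mod_cast HasOuterApproxClosed.apprSeq_apply_le_one hF n x
    have hc : Continuous fun x => (hF.apprSeq n x : ℝ) :=
      NNReal.continuous_coe.comp (hF.apprSeq n).continuous
    let φ : K →ᵇ ℝ := BoundedContinuousFunction.ofNormedAddCommGroup
      (fun x => 1 - (hF.apprSeq n x : ℝ)) (continuous_const.sub hc) 1 fun x => by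
        rw [Real.norm_eq_abs, abs_of_nonneg (by linarith [hle x])]
        linarith [NNReal.coe_nonneg (hF.apprSeq n x)]
    have hint : Integrable (fun x => (hF.apprSeq n x : ℝ)) ν :=
      Integrable.of_bound hc.measurable.aestronglyMeasurable 1
        (Eventually.of_forall fun x => by
          rw [Real.norm_eq_abs, abs_of_nonneg (NNReal.coe_nonneg _)]
          exact hle x)
    have h2 : ∫ x, φ x ∂ν = 1 - ∫ x, (hF.apprSeq n x : ℝ) ∂ν := by
      change ∫ x, (1 - (hF.apprSeq n x : ℝ)) ∂ν = _
      rw [integral_sub (integrable_const _) hint]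
      simp
    have h3 := h φ (fun x => sub_nonneg.2 (hle x))
      (fun x => sub_le_self _ (NNReal.coe_nonneg _)) (fun x hx => by
        change 1 - (hF.apprSeq n x : ℝ) = 0
        rw [HasOuterApproxClosed.apprSeq_apply_eq_one hF n hx]
        simp)
    have h4 : ∫⁻ x, hF.apprSeq n x ∂ν = ENNReal.ofReal (∫ x, (hF.apprSeq n x : ℝ) ∂ν) := by
      rw [ofReal_integral_eq_lintegral_ofReal hint
        (Eventually.of_forall fun x => NNReal.coe_nonneg _)]
      simp
    rw [h4]
    exact ENNReal.ofReal_le_ofReal (by linarith)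
  have h2 := ge_of_tendsto' (HasOuterApproxClosed.tendsto_lintegral_apprSeq hF ν) h1
  rw [ENNReal.ofReal_le_iff_le_toReal (measure_ne_top _ _)] at h2
  rw [probReal_compl_eq_one_sub hF.measurableSet]
  change 1 - (ν F).toReal ≤ ε
  linarith

/-- Riesz on the compact space `T → K` gives a measure for the transported functional. A measurable
left inverse of `ι` carries it back to `T → E`, and tightness controls the mass that this inverse
could misplace. -/
theorem exists_probabilityMeasure_integral_eq_of_injective {T E K : Type*} [TopologicalSpace E]
    [PolishSpace E] [MeasurableSpace E] [BorelSpace E] [Nonempty E] [TopologicalSpace K]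
    [PolishSpace K] [CompactSpace K] [MeasurableSpace K] [BorelSpace K] {ι : E → K}
    (hι : Continuous ι) (hinj : Function.Injective ι)
    (ℓ : ((T → E) →ᵇ ℝ) →ₗ[ℝ] ℝ) (hpos : ∀ g, 0 ≤ g → 0 ≤ ℓ g) (hone : ℓ 1 = 1)
    (htight : ∀ t, ∀ ε : ℝ, 0 < ε → ∃ C : Set E, IsCompact C ∧ HasTightCoord ℓ t C ε) :
    ∃ ℙ : ProbabilityMeasure (T → E), ∀ (f : (T → E) →ᵇ ℝ) (J : Finset T),
      DependsOn f (J : Set T) → ∫ ω, f ω ∂(ℙ : Measure (T → E)) = ℓ f := by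
  classical
  let _ := TopologicalSpace.upgradeIsCompletelyMetrizable E
  let _ := TopologicalSpace.upgradeIsCompletelyMetrizable K
  obtain ⟨x₀⟩ := ‹Nonempty E›
  have hιT : Continuous fun (ω : T → E) t => ι (ω t) :=
    continuous_pi fun t => hι.comp (continuous_apply t)
  let pull : C(T → K, ℝ) → ((T → E) →ᵇ ℝ) := fun g =>
    (BoundedContinuousFunction.mkOfCompact g).compContinuous ⟨_, hιT⟩
  let Λ : C(T → K, ℝ) →ₗ[ℝ] ℝ :=
    { toFun := fun g => ℓ (pull g)
      map_add' := fun f g => by rw [← map_add]; rfl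
      map_smul' := fun c f => by rw [RingHom.id_apply, ← map_smul]; rfl }
  obtain ⟨μ, hμ, hμΛ⟩ := exists_measure_pi_integral_eq Λ
    (fun g hg => hpos _ fun ω => hg fun t => ι (ω t)) hone
  obtain ⟨r, hr, hrι⟩ := (hι.measurableEmbedding hinj).exists_measurable_extend
    (measurable_id (α := E)) (fun _ => ⟨x₀⟩)
  have hrι' : ∀ x, r (ι x) = x := fun x => congrFun hrι x
  have hR : Measurable fun (z : T → K) t => r (z t) :=
    measurable_pi_lambda _ fun t => hr.comp (measurable_pi_apply t)
  have htail : ∀ (t : T) (C : Set E), IsCompact C → ∀ ε : ℝ, HasTightCoord ℓ t C ε →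
      μ.real {z | z t ∉ ι '' C} ≤ ε := fun t C hC ε h => by
    have h1 : Measurable fun z : T → K => z t := measurable_pi_apply t
    have : IsProbabilityMeasure (μ.map fun z => z t) :=
      Measure.isProbabilityMeasure_map h1.aemeasurable
    have hF : IsClosed (ι '' C) := (hC.image hι).isClosed
    have h2 := measureReal_compl_le (μ.map fun z => z t) hF (ε := ε) fun φ h0 h1' hφ => by
      rw [integral_map h1.aemeasurable φ.continuous.measurable.aestronglyMeasurable]
      have h3 := hμΛ ⟨fun z => φ (z t), φ.continuous.comp (continuous_apply t)⟩
        (φ.continuous.measurable.comp h1)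
      refine h3.le.trans ?_
      exact h (φ.compContinuous ⟨ι, hι⟩) (fun x => h0 _) (fun x => h1' _)
        fun x hx => hφ _ ⟨x, hx, rfl⟩
    rwa [map_measureReal_apply h1 hF.measurableSet.compl] at h2
  refine ⟨⟨μ.map fun z t => r (z t), Measure.isProbabilityMeasure_map hR.aemeasurable⟩,
    fun f J hf => ?_⟩
  let ext : (J → E) → T → E := extendPath J fun _ => x₀
  have hext : Continuous ext := continuous_extendPath J _
  have hfext : ∀ ω, f (ext fun s : J => ω s) = f ω := hf.apply_extendPath _
  have hfm : Measurable f := hf.measurable f.continuous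
  change ∫ ω, f ω ∂(μ.map fun z t => r (z t)) = ℓ f
  rw [integral_map hR.aemeasurable hfm.aestronglyMeasurable]
  -- The comparison goes through a continuous `g` on `J → K`. Replacing `f` by `g` costs `2 * ‖f‖ *
  -- J.card * ε` under the measure, and the same plus `ε` under `ℓ`.
  suffices h : ∀ ε : ℝ, 0 < ε → |∫ z, f (fun t => r (z t)) ∂μ - ℓ f| ≤
      ε * (1 + 4 * ‖f‖ * J.card) by
    rw [← sub_eq_zero, ← abs_nonpos_iff]
    refine le_of_forall_pos_le_add fun ε hε => ?_
    have hB : 0 < 1 + 4 * ‖f‖ * J.card := by positivity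
    have h1 := h (ε / (1 + 4 * ‖f‖ * J.card)) (by positivity)
    rwa [div_mul_cancel₀ _ hB.ne', ← zero_add ε] at h1
  intro ε hε
  choose C hC hCt using fun t => htight t ε hε
  let Cpi : Set (J → E) := univ.pi fun s : J => C s
  have hCpi : IsCompact Cpi := isCompact_univ_pi fun s => hC s
  have : CompactSpace Cpi := isCompact_iff_compactSpace.1 hCpi
  let incl : Cpi → J → K := fun z s => ι (z.1 s)
  have hincl : IsClosedEmbedding incl := by
    refine Continuous.isClosedEmbedding (continuous_pi fun s =>
      hι.comp ((continuous_apply s).comp continuous_subtype_val)) fun z z' h => ?_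
    exact Subtype.ext (funext fun s => hinj (congrFun h s))
  let fC : Cpi →ᵇ ℝ := f.compContinuous ⟨fun z => ext z, hext.comp continuous_subtype_val⟩
  -- Tietze: `f` restricted to the compact product, seen as a closed subset of `J → K`, extends with
  -- the same norm.
  obtain ⟨g, hgn, hg⟩ :=
    BoundedContinuousFunction.exists_extension_norm_eq_of_isClosedEmbedding fC hincl
  have hgle : ∀ z, |g z| ≤ ‖f‖ := fun z => (g.norm_coe_le_norm z).trans
    (hgn.le.trans ((BoundedContinuousFunction.norm_le (norm_nonneg f)).2 fun z =>
      f.norm_coe_le_norm _))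
  have hfle : ∀ ω, |f ω| ≤ ‖f‖ := fun ω => f.norm_coe_le_norm ω
  have hgf : ∀ ω : T → E, (∀ t ∈ J, ω t ∈ C t) → g (fun s => ι (ω s)) = f ω := fun ω h => by
    have h1 := congrFun hg ⟨fun s => ω s, fun s _ => h s s.2⟩
    exact h1.trans (hfext ω)
  let gT : C(T → K, ℝ) := ⟨fun z => g fun s : J => z s,
    g.continuous.comp (continuous_pi fun s => continuous_apply _)⟩
  have hgTm : Measurable gT :=
    g.continuous.measurable.comp (measurable_pi_lambda _ fun s => measurable_pi_apply _)
  have h1 : |ℓ (pull gT - f)| ≤ ε + (2 * ‖f‖) * (J.card * ε) := by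
    have : Nonempty E := ⟨x₀⟩
    refine abs_map_le_of_tight ℓ hpos hone hC hε hCt (fun ω ω' h => ?_) (fun ω => ?_)
      fun ω h => sub_eq_zero.2 (hgf ω h)
    · have h2 : (fun s : J => ι (ω s)) = fun s : J => ι (ω' s) :=
        funext fun s => by rw [h s s.2]
      change g (fun s : J => ι (ω s)) - f ω = g (fun s : J => ι (ω' s)) - f ω'
      rw [h2, hf h]
    · calc |g (fun s : J => ι (ω s)) - f ω| ≤ |g (fun s : J => ι (ω s))| + |f ω| := abs_sub _ _
        _ ≤ 2 * ‖f‖ := by linarith [hgle fun s : J => ι (ω s), hfle ω]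
  have hbad : ∀ t, MeasurableSet {z : T → K | z t ∉ ι '' C t} := fun t => by
    have h := ((hC t).image hι).isClosed.measurableSet.compl.preimage
      (measurable_pi_apply (X := fun _ : T => K) t)
    exact h
  have hint1 : Integrable (fun z => f fun t => r (z t)) μ :=
    Integrable.of_bound (hfm.comp hR).aestronglyMeasurable ‖f‖
      (Eventually.of_forall fun z => hfle _)
  have hint2 : Integrable gT μ :=
    Integrable.of_bound hgTm.aestronglyMeasurable ‖f‖ (Eventually.of_forall fun z => hgle _)
  have hint3 : ∀ t ∈ J, Integrable
      ({z : T → K | z t ∉ ι '' C t}.indicator fun _ => 2 * ‖f‖) μ :=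
    fun t _ => (integrable_const _).indicator (hbad t)
  have h2 : |∫ z, f (fun t => r (z t)) ∂μ - Λ gT| ≤ J.card * (2 * ‖f‖ * ε) := by
    rw [← hμΛ gT hgTm, ← integral_sub hint1 hint2]
    calc |∫ z, (f (fun t => r (z t)) - gT z) ∂μ|
        ≤ ∫ z, |f (fun t => r (z t)) - gT z| ∂μ := abs_integral_le_integral_abs
      _ ≤ ∫ z, ∑ t ∈ J, {z : T → K | z t ∉ ι '' C t}.indicator (fun _ => 2 * ‖f‖) z ∂μ := by
        refine integral_mono (hint1.sub hint2).abs (integrable_finsetSum _ hint3) fun z => ?_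
        have hnn : ∀ t ∈ J,
            0 ≤ {z : T → K | z t ∉ ι '' C t}.indicator (fun _ => 2 * ‖f‖) z :=
          fun t _ => indicator_nonneg (fun _ _ => by positivity) _
        by_cases hz : ∀ t ∈ J, z t ∈ ι '' C t
        · have h3 : gT z = f fun t => r (z t) := by
            rw [← hgf (fun t => r (z t)) fun t ht => ?_]
            · change g (fun s : J => z s) = g fun s : J => ι (r (z s))
              congr 1
              funext s
              obtain ⟨c, -, hc⟩ := hz s s.2
              rw [← hc, hrι']
            · obtain ⟨c, hcC, hc⟩ := hz t ht
              rw [← hc, hrι']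
              exact hcC
          change |f (fun t => r (z t)) - gT z| ≤ _
          rw [h3, sub_self, abs_zero]
          exact Finset.sum_nonneg hnn
        · push Not at hz
          obtain ⟨t, ht, hzt⟩ := hz
          calc |f (fun t => r (z t)) - gT z| ≤ |f fun t => r (z t)| + |gT z| := abs_sub _ _
            _ ≤ 2 * ‖f‖ := by
              have := hgle fun s : J => z s
              have h4 : |gT z| ≤ ‖f‖ := this
              linarith [hfle fun t => r (z t)]
            _ = {z : T → K | z t ∉ ι '' C t}.indicator (fun _ => 2 * ‖f‖) z :=
              (indicator_of_mem (s := {z : T → K | z t ∉ ι '' C t}) hzt fun _ => 2 * ‖f‖).symm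
            _ ≤ _ := Finset.single_le_sum
              (f := fun t => {z : T → K | z t ∉ ι '' C t}.indicator (fun _ => 2 * ‖f‖) z) hnn ht
      _ = ∑ t ∈ J, μ.real {z : T → K | z t ∉ ι '' C t} * (2 * ‖f‖) := by
        rw [integral_finsetSum _ hint3]
        exact Finset.sum_congr rfl fun t _ => by
          rw [integral_indicator_const _ (hbad t), smul_eq_mul]
      _ ≤ ∑ t ∈ J, ε * (2 * ‖f‖) := Finset.sum_le_sum fun t _ =>
        mul_le_mul_of_nonneg_right (htail t (C t) (hC t) ε (hCt t)) (by positivity)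
      _ = J.card * (2 * ‖f‖ * ε) := by
        rw [Finset.sum_const, nsmul_eq_mul]
        ring
  have h3 : Λ gT - ℓ f = ℓ (pull gT - f) := (map_sub ℓ _ _).symm
  calc |∫ z, f (fun t => r (z t)) ∂μ - ℓ f|
      ≤ |∫ z, f (fun t => r (z t)) ∂μ - Λ gT| + |Λ gT - ℓ f| := abs_sub_le _ _ _
    _ ≤ J.card * (2 * ‖f‖ * ε) + (ε + (2 * ‖f‖) * (J.card * ε)) := by
      rw [h3]
      exact add_le_add h2 h1
    _ = ε * (1 + 4 * ‖f‖ * J.card) := by ring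

/-- A positive normalized linear functional all of whose coordinates are tight is represented on the
cylinder functions by a probability measure on the product space. -/
theorem exists_probabilityMeasure_integral_eq {T E : Type*} [TopologicalSpace E] [PolishSpace E]
    [MeasurableSpace E] [BorelSpace E] [Nonempty E]
    (ℓ : ((T → E) →ᵇ ℝ) →ₗ[ℝ] ℝ) (hpos : ∀ g, 0 ≤ g → 0 ≤ ℓ g) (hone : ℓ 1 = 1)
    (htight : ∀ t, ∀ ε : ℝ, 0 < ε → ∃ C : Set E, IsCompact C ∧ HasTightCoord ℓ t C ε) :
    ∃ ℙ : ProbabilityMeasure (T → E), ∀ (f : (T → E) →ᵇ ℝ) (J : Finset T),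
      DependsOn f (J : Set T) → ∫ ω, f ω ∂(ℙ : Measure (T → E)) = ℓ f := by
  let _ := TopologicalSpace.upgradeIsCompletelyMetrizable E
  obtain ⟨ι, hι⟩ := Metric.PiNatEmbed.exists_embedding_to_hilbert_cube (X := E)
  exact exists_probabilityMeasure_integral_eq_of_injective hι.continuous hι.injective ℓ hpos hone
    htight

/-! ### Supporting functionals of convex expectations -/

/-- A monotone convex functional which preserves constants, defined on a space of bounded continuous
functions, is supported at every point by a positive normalized linear functional defined for all
bounded continuous functions. -/
theorem exists_supporting_functional {X : Type*} [TopologicalSpace X]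
    (S : Submodule ℝ (X →ᵇ ℝ)) (hS : ∀ m : ℝ, BoundedContinuousFunction.const X m ∈ S)
    (e : (X →ᵇ ℝ) → ℝ) (hmono : ∀ f ∈ S, ∀ g ∈ S, f ≤ g → e f ≤ e g)
    (hconst : ∀ m : ℝ, e (BoundedContinuousFunction.const X m) = m)
    (hconvex : ∀ f ∈ S, ∀ g ∈ S, ∀ l : ℝ, 0 ≤ l → l ≤ 1 →
      e (l • f + (1 - l) • g) ≤ l * e f + (1 - l) * e g)
    {f₀ : X →ᵇ ℝ} (hf₀ : f₀ ∈ S) :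
    ∃ ℓ : (X →ᵇ ℝ) →ₗ[ℝ] ℝ, (∀ g, 0 ≤ g → 0 ≤ ℓ g) ∧ ℓ 1 = 1 ∧
      ∀ g ∈ S, ℓ g - e g ≤ ℓ f₀ - e f₀ := by
  -- The infimum of `D G` is the directional derivative at `f₀` of the extension of `e` by infima
  -- over majorants in `S`. Using majorants defines it for all `G`, since `ℓ` is needed beyond `S`.
  let D : (X →ᵇ ℝ) → Set ℝ := fun G =>
    {d | ∃ h : ℝ, 0 < h ∧ ∃ f ∈ S, f₀ + h • G ≤ f ∧ d = (e f - e f₀) / h}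
  have happ : ∀ (f g : X →ᵇ ℝ) (x : X), f ≤ g → f x ≤ g x := fun f g x h => h x
  have hne : ∀ G, (D G).Nonempty := fun G =>
    ⟨_, 1, one_pos, BoundedContinuousFunction.const X (‖f₀‖ + ‖G‖), hS _, fun x => by
      have h1 := (le_abs_self _).trans (f₀.norm_coe_le_norm x)
      have h2 := (le_abs_self _).trans (G.norm_coe_le_norm x)
      change f₀ x + 1 * G x ≤ ‖f₀‖ + ‖G‖
      linarith, rfl⟩
  have hbdd : ∀ G, BddBelow (D G) := fun G => by
    refine ⟨e f₀ - e (f₀ + BoundedContinuousFunction.const X ‖G‖), ?_⟩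
    rintro d ⟨h, hh, f, hf, hle, rfl⟩
    set k := f₀ + BoundedContinuousFunction.const X ‖G‖ with hk
    have hkS : k ∈ S := S.add_mem hf₀ (hS _)
    -- The weight `1 / (1 + h)` makes the gain `‖G‖` in `k` cancel the worst case of `h • G`, so
    -- that convexity bounds the quotient from below.
    have h1 : f₀ ≤ (1 / (1 + h)) • f + (1 - 1 / (1 + h)) • k := fun x => by
      have h2 := happ _ _ x hle
      have h3 : f₀ x + h * G x ≤ f x := h2
      have h4 := neg_le_of_abs_le (G.norm_coe_le_norm x)
      change f₀ x ≤ (1 / (1 + h)) * f x + (1 - 1 / (1 + h)) * (f₀ x + ‖G‖)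
      have h5 : (1 / (1 + h)) * f x + (1 - 1 / (1 + h)) * (f₀ x + ‖G‖) - f₀ x
          = (f x - f₀ x + h * ‖G‖) / (1 + h) := by
        field_simp
        ring
      have h6 : 0 ≤ (f x - f₀ x + h * ‖G‖) / (1 + h) :=
        div_nonneg (by nlinarith) (by linarith)
      linarith
    have h2 := (hmono _ hf₀ _ (S.add_mem (S.smul_mem _ hf) (S.smul_mem _ hkS)) h1).trans
      (hconvex f hf k hkS (1 / (1 + h)) (by positivity)
        (by rw [div_le_one (by linarith)]; linarith))
    have h3 : (1 / (1 + h)) * e f + (1 - 1 / (1 + h)) * e k = (e f + h * e k) / (1 + h) := by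
      field_simp
      ring
    rw [h3, le_div_iff₀ (by linarith)] at h2
    rw [le_div_iff₀ hh]
    linarith
  have hle : ∀ G, ∀ d ∈ D G, sInf (D G) ≤ d := fun G d hd => csInf_le (hbdd G) hd
  have hhom' : ∀ c : ℝ, 0 < c → ∀ G, sInf (D (c • G)) ≤ c * sInf (D G) := fun c hc G => by
    rw [← div_le_iff₀' hc]
    refine le_csInf (hne G) ?_
    rintro d ⟨h, hh, f, hf, hfle, rfl⟩
    rw [div_le_iff₀' hc]
    refine hle _ _ ⟨h / c, by positivity, f, hf, ?_, by field_simp⟩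
    rwa [smul_smul, div_mul_cancel₀ _ hc.ne']
  have hhom : ∀ c : ℝ, 0 < c → ∀ G, sInf (D (c • G)) = c * sInf (D G) := fun c hc G => by
    refine le_antisymm (hhom' c hc G) ?_
    have h1 := hhom' c⁻¹ (inv_pos.2 hc) (c • G)
    rwa [inv_smul_smul₀ hc.ne', ← div_eq_inv_mul, le_div_iff₀' hc] at h1
  have hadd : ∀ G H, sInf (D (G + H)) ≤ sInf (D G) + sInf (D H) := fun G H => by
    rw [← sub_le_iff_le_add]
    refine le_csInf (hne G) fun d hd => ?_
    rw [sub_le_comm]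
    refine le_csInf (hne H) fun d' hd' => ?_
    rw [sub_le_iff_le_add]
    obtain ⟨h, hh, f, hf, hfle, rfl⟩ := hd
    obtain ⟨h', hh', f', hf', hfle', rfl⟩ := hd'
    have hl : 1 - h' / (h + h') = h / (h + h') := by field_simp; ring
    -- With these weights the convex combination of the two majorants dominates `f₀` plus one common
    -- step times `G + H`.
    refine (hle _ _ ⟨h * h' / (h + h'), by positivity,
      (h' / (h + h')) • f + (1 - h' / (h + h')) • f',
      S.add_mem (S.smul_mem _ hf) (S.smul_mem _ hf'), fun x => ?_, rfl⟩).trans ?_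
    · have h1 : f₀ x + h * G x ≤ f x := happ _ _ x hfle
      have h2 : f₀ x + h' * H x ≤ f' x := happ _ _ x hfle'
      rw [hl]
      change f₀ x + (h * h' / (h + h')) * (G x + H x) ≤
        (h' / (h + h')) * f x + (h / (h + h')) * f' x
      have h3 : f₀ x + (h * h' / (h + h')) * (G x + H x) =
          (h' / (h + h')) * (f₀ x + h * G x) + (h / (h + h')) * (f₀ x + h' * H x) := by
        field_simp
        ring
      rw [h3]
      gcongr
    · have h1 := hconvex f hf f' hf' (h' / (h + h')) (by positivity)
        (by rw [div_le_one (by linarith)]; linarith)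
      rw [div_le_iff₀ (by positivity)]
      have h2 : ((e f' - e f₀) / h' + (e f - e f₀) / h) * (h * h' / (h + h')) =
          (h' / (h + h')) * e f + (1 - h' / (h + h')) * e f' - e f₀ := by
        rw [hl]
        field_simp
        ring
      linarith
  have h00 : sInf (D 0) = 0 := by
    have := hhom 2 two_pos 0
    rw [smul_zero] at this
    linarith
  obtain ⟨ℓ, -, hℓ⟩ := exists_extension_of_le_sublinear
    (⊥ : (X →ᵇ ℝ) →ₗ.[ℝ] ℝ) (fun G => sInf (D G)) hhom hadd (by
      rintro ⟨x, hx⟩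
      obtain rfl : x = 0 := hx
      change (⊥ : (X →ᵇ ℝ) →ₗ.[ℝ] ℝ) 0 ≤ _
      rw [LinearPMap.map_zero, h00])
  have hℓ' : ∀ G, ∀ f ∈ S, f₀ + G ≤ f → ℓ G ≤ e f - e f₀ := fun G f hf h =>
    (hℓ G).trans (hle _ _ ⟨1, one_pos, f, hf, by rwa [one_smul], by rw [div_one]⟩)
  refine ⟨ℓ, fun g hg => ?_, ?_, fun g hg => ?_⟩
  -- For `g ≥ 0`, `f₀` itself majorizes `f₀ - g`.
  · have h1 := hℓ' (-g) f₀ hf₀ (by simpa using hg)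
    rw [map_neg, sub_self] at h1
    linarith
  -- A linear function of `m ∈ ℝ` that is bounded above has slope zero, here `ℓ 1 - 1`.
  · have h1 : ∀ m : ℝ, m * (ℓ 1 - 1) ≤ ‖f₀‖ - e f₀ := fun m => by
      have h2 := hℓ' (m • 1) (BoundedContinuousFunction.const X (‖f₀‖ + m)) (hS _) fun x => by
        have h3 := (le_abs_self _).trans (f₀.norm_coe_le_norm x)
        change f₀ x + m * 1 ≤ ‖f₀‖ + m
        linarith
      rw [map_smul, hconst, smul_eq_mul] at h2
      linarith
    by_contra hne
    have h2 := h1 ((‖f₀‖ - e f₀ + 1) / (ℓ 1 - 1))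
    rw [div_mul_cancel₀ _ (sub_ne_zero.2 hne)] at h2
    linarith
  · have h1 := hℓ' (g - f₀) g hg (by rw [add_sub_cancel])
    rw [map_sub] at h1
    linarith

/-! ### Convex expectations as penalized suprema -/

theorem integrable_of_bddMeas {Ω : Type u} [MeasurableSpace Ω] (Y : BddMeas Ω) (μ : Measure Ω)
    [IsFiniteMeasure μ] : Integrable Y.1 μ := by
  obtain ⟨hm, K, hK⟩ := Y.2
  exact Integrable.of_bound hm.aestronglyMeasurable K (Eventually.of_forall hK)

theorem bddAbove_integral_sub {Ω : Type u} [MeasurableSpace Ω] {𝓠 : Set (ProbabilityMeasure Ω)}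
    (α : 𝓠 → ℝ≥0) (Y : BddMeas Ω) : BddAbove (range fun ℙ : 𝓠 =>
      (∫ ω, Y.1 ω ∂(ℙ.1 : Measure Ω)) - (α ℙ : ℝ)) := by
  obtain ⟨-, K, hK⟩ := id Y.2
  refine ⟨K, ?_⟩
  rintro _ ⟨ℙ, rfl⟩
  have h1 : ∫ ω, Y.1 ω ∂(ℙ.1 : Measure Ω) ≤ ∫ _, K ∂(ℙ.1 : Measure Ω) :=
    integral_mono (integrable_of_bddMeas Y _) (integrable_const _) fun ω => (le_abs_self _).trans (hK ω)
  rw [integral_const, probReal_univ, one_smul] at h1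
  linarith [NNReal.coe_nonneg (α ℙ)]

/-- A penalized supremum of expectations is a convex expectation, if the penalty has infimum
zero. -/
theorem isConvexExpectationSpace_iSup {Ω : Type u} [MeasurableSpace Ω]
    (𝓠 : Set (ProbabilityMeasure Ω)) (α : 𝓠 → ℝ≥0)
    (hα : IsLUB (range fun ℙ : 𝓠 => -(α ℙ : ℝ)) 0) :
    IsConvexExpectationSpace Ω fun Y =>
      ⨆ ℙ : 𝓠, (∫ ω, Y.1 ω ∂(ℙ.1 : Measure Ω)) - (α ℙ : ℝ) := by
  have : Nonempty 𝓠 := range_nonempty_iff_nonempty.1 hα.nonempty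
  refine ⟨⟨fun Y Z h => ?_, fun m => ?_, fun Y Z l h0 h1 => ?_⟩, 𝓠, α, fun Y =>
    isLUB_ciSup (bddAbove_integral_sub α Y)⟩
  · exact ciSup_mono (bddAbove_integral_sub α Z) fun ℙ =>
      sub_le_sub_right (integral_mono (integrable_of_bddMeas Y _) (integrable_of_bddMeas Z _) h) _
  · have h2 : (fun ℙ : 𝓠 => (∫ ω, (BddMeas.const Ω m).1 ω ∂(ℙ.1 : Measure Ω)) - (α ℙ : ℝ)) =
        fun ℙ => m + -(α ℙ : ℝ) := by
      funext ℙ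
      change (∫ _, m ∂(ℙ.1 : Measure Ω)) - (α ℙ : ℝ) = _
      rw [integral_const, probReal_univ, one_smul, sub_eq_add_neg]
    rw [h2, ← add_ciSup hα.bddAbove, hα.ciSup_eq, add_zero]
  · refine ciSup_le fun ℙ => ?_
    have hY := le_ciSup (bddAbove_integral_sub α Y) ℙ
    have hZ := le_ciSup (bddAbove_integral_sub α Z) ℙ
    have h2 : ∫ ω, (l • Y + (1 - l) • Z).1 ω ∂(ℙ.1 : Measure Ω) =
        l * ∫ ω, Y.1 ω ∂(ℙ.1 : Measure Ω) + (1 - l) * ∫ ω, Z.1 ω ∂(ℙ.1 : Measure Ω) := by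
      rw [← integral_const_mul, ← integral_const_mul,
        ← integral_add ((integrable_of_bddMeas Y _).const_mul l) ((integrable_of_bddMeas Z _).const_mul (1 - l))]
      rfl
    rw [h2]
    have h3 := mul_le_mul_of_nonneg_left hY h0
    have h4 := mul_le_mul_of_nonneg_left hZ (sub_nonneg.2 h1)
    linarith

/-! ### The convex expectation on the path space -/

section PathExpectation

variable {E : Type u} [TopologicalSpace E]

/-- The cylinder functions form a subspace of the bounded continuous functions. -/
def cylinderSubmodule (E : Type u) [TopologicalSpace E] : Submodule ℝ ((ℝ≥0 → E) →ᵇ ℝ) where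
  carrier := {f | IsCylinder f}
  add_mem' hf hg := IsCylinder.add hf hg
  zero_mem' := isCylinder_const 0
  smul_mem' c _ hf := IsCylinder.smul hf c

variable [MeasurableSpace E]

/-- The differences between the expectations of cylinder functions under `ℙ` and their values under
`cylinderExp P x`. -/
def excess (P : ℝ≥0 → (E →ᵇ ℝ) → (E →ᵇ ℝ)) (x : E) (ℙ : ProbabilityMeasure (ℝ≥0 → E)) : Set ℝ :=
  (fun f : (ℝ≥0 → E) →ᵇ ℝ => ∫ ω, f ω ∂(ℙ : Measure (ℝ≥0 → E)) - cylinderExp P x f) ''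
    {f | IsCylinder f}

/-- The path measures of finite penalty. -/
def pathMeasures (P : ℝ≥0 → (E →ᵇ ℝ) → (E →ᵇ ℝ)) (x : E) : Set (ProbabilityMeasure (ℝ≥0 → E)) :=
  {ℙ | BddAbove (excess P x ℙ)}

/-- The penalty of a path measure. -/
def penalty (P : ℝ≥0 → (E →ᵇ ℝ) → (E →ᵇ ℝ)) (x : E) (ℙ : pathMeasures P x) : ℝ≥0 :=
  (sSup (excess P x ℙ.1)).toNNReal

/-- The convex expectation on the path space for the paths starting in `x`. -/
def pathExp (P : ℝ≥0 → (E →ᵇ ℝ) → (E →ᵇ ℝ)) (x : E) (Y : BddMeas (ℝ≥0 → E)) : ℝ :=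
  ⨆ ℙ : pathMeasures P x, (∫ ω, Y.1 ω ∂(ℙ.1 : Measure (ℝ≥0 → E))) - (penalty P x ℙ : ℝ)

variable {P : ℝ≥0 → (E →ᵇ ℝ) → (E →ᵇ ℝ)} [PolishSpace E]

theorem IsCylinder.mem_bddMeas [BorelSpace E] {f : (ℝ≥0 → E) →ᵇ ℝ} (hf : IsCylinder f) :
    (fun ω => f ω) ∈ BddMeas (ℝ≥0 → E) := by
  obtain ⟨J, hJ⟩ := hf
  exact ⟨hJ.measurable f.continuous, ‖f‖, f.norm_coe_le_norm⟩

namespace IsConvexMarkovSemigroup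

/-- This makes the supremum in `penalty` nonnegative, so that `Real.toNNReal` truncates nothing. -/
theorem zero_mem_excess (hP : IsConvexMarkovSemigroup P) (x : E)
    (ℙ : ProbabilityMeasure (ℝ≥0 → E)) : 0 ∈ excess P x ℙ := by
  refine ⟨BoundedContinuousFunction.const _ 0, isCylinder_const 0, ?_⟩
  change ∫ _, (0 : ℝ) ∂(ℙ : Measure (ℝ≥0 → E)) - _ = 0
  rw [hP.cylinderExp_const, integral_zero, sub_zero]

theorem coe_penalty (hP : IsConvexMarkovSemigroup P) (x : E) (ℙ : pathMeasures P x) :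
    (penalty P x ℙ : ℝ) = sSup (excess P x ℙ.1) :=
  Real.coe_toNNReal _ (le_csSup ℙ.2 (hP.zero_mem_excess x ℙ.1))

variable [BorelSpace E]

/-- The value of a cylinder function is attained at a path measure. -/
theorem exists_pathMeasure (hP : IsConvexMarkovSemigroup P) (x : E) {f₀ : (ℝ≥0 → E) →ᵇ ℝ}
    (hf₀ : IsCylinder f₀) : ∃ ℙ : pathMeasures P x,
      cylinderExp P x f₀ ≤ ∫ ω, f₀ ω ∂(ℙ.1 : Measure (ℝ≥0 → E)) - (penalty P x ℙ : ℝ) := by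
  obtain ⟨ℓ, hpos, hone, hℓ⟩ := exists_supporting_functional (cylinderSubmodule E)
    isCylinder_const (cylinderExp P x) (fun f hf g hg h => hP.cylinderExp_mono x hf hg h)
    (hP.cylinderExp_const x) (fun f hf g hg l h0 h1 => hP.cylinderExp_convex x hf hg h0 h1)
    (f₀ := f₀) hf₀
  set c := ℓ f₀ - cylinderExp P x f₀ with hc
  have hc0 : 0 ≤ c := by
    have h1 := hℓ 0 (cylinderSubmodule E).zero_mem
    have h2 : cylinderExp P x 0 = 0 := hP.cylinderExp_const x 0
    rwa [map_zero, h2, sub_zero] at h1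
  have : Nonempty E := ⟨x⟩
  obtain ⟨ℙ, hℙ⟩ := exists_probabilityMeasure_integral_eq ℓ hpos hone fun t ε hε => by
    -- The nonlinear semigroup cannot be rescaled, so the test function is scaled beforehand: `(1 +
    -- c) / ε * ℓ (evalAt t φ)` is at most `c` plus a semigroup value below `1`, and dividing leaves
    -- `ε`.
    have hl : 0 < (1 + c) / ε := by positivity
    obtain ⟨C, hC, hCP⟩ := hP.exists_compact_lt t x hl.le
    refine ⟨C, hC, fun φ h0 h1 hφ => ?_⟩
    have h2 := hCP (((1 + c) / ε) • φ) (fun y => by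
      change |(1 + c) / ε * φ y| ≤ _
      rw [abs_of_nonneg (mul_nonneg hl.le (h0 y))]
      exact mul_le_of_le_one_right hl.le (h1 y)) fun y hy => by
        change (1 + c) / ε * φ y = 0
        rw [hφ y hy, mul_zero]
    have h3 := hℓ (evalAt t (((1 + c) / ε) • φ)) ⟨{t}, dependsOn_evalAt t _⟩
    rw [hP.cylinderExp_evalAt, show evalAt t (((1 + c) / ε) • φ) = ((1 + c) / ε) • evalAt t φ
      from rfl, map_smul, smul_eq_mul] at h3
    have h4 : (1 + c) / ε * ℓ (evalAt t φ) ≤ (1 + c) / ε * ε := by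
      rw [div_mul_cancel₀ _ hε.ne']
      linarith
    exact le_of_mul_le_mul_left h4 hl
  have hbound : ∀ d ∈ excess P x ℙ, d ≤ c := by
    rintro _ ⟨f, hf, rfl⟩
    obtain ⟨J, hJ⟩ := id hf
    exact (congrArg (· - cylinderExp P x f) (hℙ f J hJ)).le.trans (hℓ f hf)
  refine ⟨⟨ℙ, c, hbound⟩, ?_⟩
  obtain ⟨J, hJ⟩ := hf₀
  rw [hP.coe_penalty, hℙ f₀ J hJ]
  have h1 := csSup_le ⟨0, hP.zero_mem_excess x ℙ⟩ hbound
  linarith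

/-- The upper bound is the Fenchel inequality contained in the penalty; `exists_pathMeasure` shows
that it is attained. -/
theorem isLUB_cylinderExp (hP : IsConvexMarkovSemigroup P) (x : E) {f : (ℝ≥0 → E) →ᵇ ℝ}
    (hf : IsCylinder f) : IsLUB (range fun ℙ : pathMeasures P x =>
      (∫ ω, f ω ∂(ℙ.1 : Measure (ℝ≥0 → E))) - (penalty P x ℙ : ℝ)) (cylinderExp P x f) := by
  refine ⟨?_, fun b hb => ?_⟩
  · rintro _ ⟨ℙ, rfl⟩
    have h1 := le_csSup ℙ.2 ⟨f, hf, rfl⟩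
    rw [← hP.coe_penalty x ℙ] at h1
    change _ - _ ≤ _
    linarith
  · obtain ⟨ℙ, h⟩ := hP.exists_pathMeasure x hf
    exact h.trans (hb ⟨ℙ, rfl⟩)

theorem isConvexExpectationSpace_pathExp (hP : IsConvexMarkovSemigroup P) (x : E) :
    IsConvexExpectationSpace (ℝ≥0 → E) (pathExp P x) := by
  refine isConvexExpectationSpace_iSup (pathMeasures P x) (penalty P x) ?_
  have h1 := hP.isLUB_cylinderExp x (isCylinder_const 0)
  rw [hP.cylinderExp_const] at h1
  simpa using h1

/-- Duality without gap: `pathExp` extends `cylinderExp`, so the Markov property and the one-time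
values carry over. -/
theorem pathExp_eq (hP : IsConvexMarkovSemigroup P) (x : E) {f : (ℝ≥0 → E) →ᵇ ℝ}
    (hf : IsCylinder f) {Y : (ℝ≥0 → E) → ℝ} (hYf : Y = f) (hY : Y ∈ BddMeas (ℝ≥0 → E)) :
    pathExp P x ⟨Y, hY⟩ = cylinderExp P x f := by
  subst hYf
  obtain ⟨ℙ, -⟩ := hP.exists_pathMeasure x hf
  have : Nonempty (pathMeasures P x) := ⟨ℙ⟩
  exact (hP.isLUB_cylinderExp x hf).ciSup_eq

theorem pathExp_evalAt (hP : IsConvexMarkovSemigroup P) (t : ℝ≥0) (x : E) (φ : E →ᵇ ℝ) :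
    ∃ hY : (fun ω : ℝ≥0 → E => φ (ω t)) ∈ BddMeas (ℝ≥0 → E), P t φ x = pathExp P x ⟨_, hY⟩ := by
  have hf : IsCylinder (evalAt t φ) := ⟨{t}, dependsOn_evalAt t φ⟩
  exact ⟨hf.mem_bddMeas, ((hP.pathExp_eq x hf rfl _).trans (hP.cylinderExp_evalAt x t φ)).symm⟩

end IsConvexMarkovSemigroup

end PathExpectation

end

/-! ### The coordinate process -/

theorem mainTheorem7 {E : Type u} [TopologicalSpace E] [PolishSpace E]
    [MeasurableSpace E] [BorelSpace E]
    (P : ℝ≥0 → (E →ᵇ ℝ) → (E →ᵇ ℝ))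
    (hP : IsMixedC0Semigroup P)
    (hmono : ∀ t, Monotone (P t))
    (hconvex : ∀ t (φ₁ φ₂ : E →ᵇ ℝ) (l : ℝ), 0 ≤ l → l ≤ 1 →
      P t (l • φ₁ + (1 - l) • φ₂) ≤ l • P t φ₁ + (1 - l) • P t φ₂)
    (hconst : ∀ t (m : ℝ),
      P t (BoundedContinuousFunction.const E m) = BoundedContinuousFunction.const E m) :
    ∃ (Ω : Type u) (_ : MeasurableSpace Ω) (𝓔 : E → BddMeas Ω → ℝ) (X : ℝ≥0 → Ω → E),
      (∀ t, Measurable (X t)) ∧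
      (∀ x, IsConvexExpectationSpace Ω (𝓔 x)) ∧
      (∀ x (φ : E →ᵇ ℝ), ∃ hY : (fun ω => φ (X 0 ω)) ∈ BddMeas Ω, 𝓔 x ⟨_, hY⟩ = φ x) ∧
      (∀ x (s t : ℝ≥0), s < t → ∀ (n : ℕ) (r : Fin n → ℝ≥0), StrictMono r → (∀ k, r k ≤ s) →
        ∀ ψ : (Fin (n + 1) → E) →ᵇ ℝ,
          ∃ (hY : (fun ω => ψ (Fin.snoc (α := fun _ => E) (fun k => X (r k) ω) (X t ω)))
                ∈ BddMeas Ω)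
            (hZ : (fun ω => P (t - s) (sliceLast ψ fun k => X (r k) ω) (X s ω)) ∈ BddMeas Ω),
            𝓔 x ⟨_, hY⟩ = 𝓔 x ⟨_, hZ⟩) ∧
      (∀ t x (φ : E →ᵇ ℝ), ∃ hY : (fun ω => φ (X t ω)) ∈ BddMeas Ω,
        P t φ x = 𝓔 x ⟨_, hY⟩) := by
  have hP' : IsConvexMarkovSemigroup P := ⟨hP, hmono, hconvex, hconst⟩
  refine ⟨ℝ≥0 → E, MeasurableSpace.pi, pathExp P, fun t ω => ω t, measurable_pi_apply,
    hP'.isConvexExpectationSpace_pathExp, fun x φ => ?_, fun x s t hst n r _ hrs ψ => ?_,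
    fun t x φ => hP'.pathExp_evalAt t x φ⟩
  · obtain ⟨hY, h⟩ := hP'.pathExp_evalAt 0 x φ
    exact ⟨hY, by rw [← h, hP.zero]⟩
  · let f : (ℝ≥0 → E) →ᵇ ℝ := ψ.compContinuous
      ⟨fun ω => Fin.snoc (α := fun _ => E) (fun k => ω (r k)) (ω t),
        (continuous_pi fun k => continuous_apply (r k)).finSnoc (continuous_apply t)⟩
    have hf : DependsOn f (insert t (Finset.univ.image r : Finset ℝ≥0) : Set ℝ≥0) :=
      fun ω ω' h => by
        have h1 : (fun k => ω (r k)) = fun k => ω' (r k) := funext fun k => h _ (by simp)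
        change ψ (Fin.snoc (α := fun _ => E) (fun k => ω (r k)) (ω t)) =
          ψ (Fin.snoc (α := fun _ => E) (fun k => ω' (r k)) (ω' t))
        rw [h1, h t (by simp)]
    have hc : IsCylinder f := ⟨insert t (Finset.univ.image r), by rwa [Finset.coe_insert]⟩
    have hc' := hP'.isCylinder_transition hc s t
    -- Since all `r k` lie strictly before `t`, changing the path at `t` only affects the last
    -- argument of `ψ`; the right-hand side of the Markov property is therefore a transition of `f`.
    have hZ : (fun ω : ℝ≥0 → E => P (t - s) (sliceLast ψ fun k => ω (r k)) (ω s)) =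
        transition P s t f := by
      funext ω
      rw [hP'.transition_apply hc]
      congr 2
      ext y
      change ψ _ = ψ (Fin.snoc (α := fun _ => E) (fun k => Function.update ω t y (r k))
        (Function.update ω t y t))
      have h1 : (fun k => Function.update ω t y (r k)) = fun k => ω (r k) :=
        funext fun k => Function.update_of_ne ((hrs k).trans_lt hst).ne _ _
      rw [Function.update_self, h1]
      rfl
    refine ⟨hc.mem_bddMeas, ?_, ?_⟩
    · rw [hZ]
      exact hc'.mem_bddMeas
    · refine (hP'.pathExp_eq x hc rfl _).trans (Eq.trans ?_ (hP'.pathExp_eq x hc' hZ _).symm)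
      refine (hP'.cylinderExp_transition x hst (fun q hq => ?_) hf).symm
      obtain ⟨k, -, rfl⟩ := Finset.mem_image.1 hq
      exact hrs k
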